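/- Let $g\ge 1$, let $\mathcal H_g$ be the Siegel upper half space of symmetric complex $g\times g$ matrices $\tau=X+iY$ with $Y>0$, and let $\Gamma_g=\mathrm{Sp}(2g,\mathbb Z)$ act on it by $\gamma(\tau)=(a\tau+b)(c\tau+d)^{-1}$. Let $P_{g,1}\subset \mathrm{Sp}(2g,\mathbb R)$ be the parabolic subgroup that preserves the line spanned by the first basis vector. For $\tau\in\mathcal H_g$ write $\tau_{22}$ for the lower right $(g-1)\times(g-1)$ block of $\tau$ (with $\det \operatorname{Im}(\tau_{22})=1$ if $g=1$), and let $$E_{g,1}(\tau,s)=\sum_{\gamma\in(\Gamma_g\cap P_{g,1})\backslash\Gamma_g}\left(\frac{\det \operatorname{Im}\gamma(\tau)}{\det \operatorname{Im}(\gamma(\tau)_{22})}\right)^{s},\qquad \operatorname{Re}(s)>g .$$ Let $G$ be the $\mathrm{Sp}(2g,\mathbb R)$-invariant Riemannian metric $ds^2=\kappa\,\bigl(\operatorname{Tr}(Y^{-1}dX\,Y^{-1}dX)+\operatorname{Tr}(Y^{-1}dY\,Y^{-1}dY)\bigr)$ on $\mathcal H_g$, where $\kappa>0$ is normalized so that the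 Riemannian volume in the coordinates $X_{ij},Y_{ij}$ $(i\le j)$ is the invariant measure $\det(Y)^{-(g+1)}\prod_{i\le j}dX_{ij}\,dY_{ij}$, and let $\Delta=-\frac{1}{\sqrt{|G|}}\,\partial_I\sqrt{|G|}\,G^{IJ}\partial_J$ be its Laplacian. Then: (1) the terms of the series depend only on the coset of $\gamma$; (2) for $\operatorname{Re}(s)>g$ the series converges absolutely for every $\tau\in\mathcal H_g$, its sum is a $C^2$ function of $\tau$, and $$\Delta E_{g,1}(\tau,s)=2^{\frac{g-1}{g+1}}\,s(g-s)\,E_{g,1}(\tau,s);$$ (3) the same equation holds for analytic continuations in $s$: if $U\subset\mathbb C$ is open, connected and meets $\{\operatorname{Re}(s)>g\}$, and $F:\mathcal H_g\times U\to\mathbb C$ is jointly $C^2$, holomorphic in $s$, and equal to $E_{g,1}(\tau,s)$ for $s\in U$ with $\operatorname{Re}(s)>g$, then $\Delta F(\tau,s)=2^{\frac{g-1}{g+1}}\,s(g-s)\,F(\tau,s)$ for all $\tau\in\mathcal H_g$ and $s\in U$. -/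

import Mathlib

open Matrix

namespace Siegel

noncomputable section

/-- The Siegel upper half space of genus `g`: symmetric complex `g × g` matrices whose imaginary
part is positive definite. -/
def upperHalfSpace (g : ℕ) : Set (Matrix (Fin g) (Fin g) ℂ) :=
  {τ | τᵀ = τ ∧ (τ.map Complex.im).PosDef}

/-- The fractional linear action `τ ↦ (aτ + b)(cτ + d)⁻¹` of a real `2g × 2g` matrix with blocks
`a, b, c, d`. -/
def moebius {g : ℕ} (M : Matrix (Fin g ⊕ Fin g) (Fin g ⊕ Fin g) ℝ)
    (τ : Matrix (Fin g) (Fin g) ℂ) : Matrix (Fin g) (Fin g) ℂ :=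
  (M.toBlocks₁₁.map Complex.ofReal * τ + M.toBlocks₁₂.map Complex.ofReal) *
    (M.toBlocks₂₁.map Complex.ofReal * τ + M.toBlocks₂₂.map Complex.ofReal)⁻¹

/-- The modular group `Γ_g = Sp(2g, ℤ)`. -/
abbrev modularGroup (g : ℕ) : Type := symplecticGroup (Fin g) ℤ

/-- The action of `Sp(2g, ℤ)` on the Siegel upper half space. -/
def act {g : ℕ} (γ : modularGroup g) (τ : Matrix (Fin g) (Fin g) ℂ) : Matrix (Fin g) (Fin g) ℂ :=
  moebius (γ.1.map (fun k : ℤ => (k : ℝ))) τ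

/-- The points of the maximal parabolic subgroup `P_{g,1}` over a commutative ring `R` (the
stabilizer of the boundary component `F_{g-1}`): the symplectic matrices which preserve the line
spanned by the first basis vector, i.e. those of the block form
`(t m q n; 0 a * b; 0 0 t⁻¹ 0; 0 c * d)` with respect to `2g = 1 + (g-1) + 1 + (g-1)`. -/
def parabolic (g : ℕ) [NeZero g] (R : Type*) [CommRing R] : Subgroup (symplecticGroup (Fin g) R) where
  carrier := {γ | ∃ t : R, γ.1 *ᵥ Pi.single (Sum.inl 0) 1 = t • Pi.single (Sum.inl 0) 1}
  one_mem' := ⟨1, by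
    change (1 : Matrix (Fin g ⊕ Fin g) (Fin g ⊕ Fin g) R) *ᵥ _ = _
    rw [Matrix.one_mulVec, one_smul]⟩
  mul_mem' := by
    rintro a b ⟨t, ht⟩ ⟨u, hu⟩
    refine ⟨u * t, ?_⟩
    change (a.1 * b.1) *ᵥ _ = _
    rw [← Matrix.mulVec_mulVec, hu, Matrix.mulVec_smul, ht, smul_smul]
  inv_mem' := by
    rintro a ⟨t, ht⟩
    have h1 : (a⁻¹).1 * a.1 = 1 := congrArg Subtype.val (inv_mul_cancel a)
    have h2 : (Pi.single (Sum.inl 0) 1 : Fin g ⊕ Fin g → R)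
        = t • ((a⁻¹).1 *ᵥ Pi.single (Sum.inl 0) 1) := by
      rw [← Matrix.mulVec_smul, ← ht, Matrix.mulVec_mulVec, h1, Matrix.one_mulVec]
    have h3 : t * ((a⁻¹).1 *ᵥ Pi.single (Sum.inl 0) 1) (Sum.inl 0) = 1 := by
      have := congrFun h2 (Sum.inl 0)
      simpa using this.symm
    refine ⟨((a⁻¹).1 *ᵥ Pi.single (Sum.inl 0) 1) (Sum.inl 0), ?_⟩
    calc (a⁻¹).1 *ᵥ Pi.single (Sum.inl 0) 1
        = (((a⁻¹).1 *ᵥ Pi.single (Sum.inl 0) 1) (Sum.inl 0) * t) •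
            ((a⁻¹).1 *ᵥ Pi.single (Sum.inl 0) 1) := by rw [mul_comm, h3, one_smul]
      _ = ((a⁻¹).1 *ᵥ Pi.single (Sum.inl 0) 1) (Sum.inl 0) • Pi.single (Sum.inl 0) 1 := by
        rw [mul_smul, ← h2]

/-- `det (Im τ) / det (Im τ₂₂)`, where `τ₂₂` is the lower right `(g-1) × (g-1)` block of `τ`. -/
def height {g : ℕ} [NeZero g] (τ : Matrix (Fin g) (Fin g) ℂ) : ℝ :=
  (τ.map Complex.im).det /
    ((τ.map Complex.im).submatrix (fun i : {i : Fin g // i ≠ 0} => i.1) (fun i => i.1)).det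

/-- The coset space `(Γ_g ∩ P_{g,1}) \ Γ_g`. -/
abbrev Cosets (g : ℕ) [NeZero g] : Type :=
  Quotient (QuotientGroup.rightRel (parabolic g ℤ))

/-- The term of the Eisenstein series which belongs to a coset, computed with a representative. -/
def eisensteinTerm {g : ℕ} [NeZero g] (τ : Matrix (Fin g) (Fin g) ℂ) (s : ℂ) (x : Cosets g) : ℂ :=
  ((height (act x.out τ) : ℝ) : ℂ) ^ s

/-- The Eisenstein series `E_{g,1}(τ, s)`. -/
def eisenstein {g : ℕ} [NeZero g] (τ : Matrix (Fin g) (Fin g) ℂ) (s : ℂ) : ℂ :=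
  ∑' x : Cosets g, eisensteinTerm τ s x

/-- Index set of the `g(g+1)` real coordinates: `inl {i, j}` stands for `Re τ_{ij}` and
`inr {i, j}` for `Im τ_{ij}`, one for each unordered pair `{i, j}`. -/
abbrev CoordIndex (g : ℕ) : Type := Sym2 (Fin g) ⊕ Sym2 (Fin g)

/-- The symmetric complex matrix with given coordinates. -/
def ofCoords {g : ℕ} (p : CoordIndex g → ℝ) : Matrix (Fin g) (Fin g) ℂ :=
  Matrix.of fun i j => (p (Sum.inl s(i, j)) : ℂ) + (p (Sum.inr s(i, j)) : ℂ) * Complex.I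

/-- The coordinates of a symmetric complex matrix. -/
def coords {g : ℕ} (τ : Matrix (Fin g) (Fin g) ℂ) : CoordIndex g → ℝ :=
  Sum.elim (fun z => (τ z.inf z.sup).re) (fun z => (τ z.inf z.sup).im)

theorem ofCoords_coords {g : ℕ} {τ : Matrix (Fin g) (Fin g) ℂ} (h : τᵀ = τ) :
    ofCoords (coords τ) = τ := by
  have hs : ∀ i j, τ (i ⊓ j) (i ⊔ j) = τ i j := by
    intro i j
    rcases le_total i j with hij | hij
    · simp [hij]
    · rw [inf_eq_right.2 hij, sup_eq_left.2 hij]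
      exact congrFun (congrFun h i) j
  ext i j
  simp [ofCoords, coords, hs]

/-- The coordinate domain of the Siegel upper half space. -/
def coordDomain (g : ℕ) : Set (CoordIndex g → ℝ) := {p | ofCoords p ∈ upperHalfSpace g}

/-- The `Sp(2g, ℝ)`-invariant Riemannian metric
`ds² = c · Tr(Y⁻¹ dτ Y⁻¹ dτ̄) = c · (Tr(Y⁻¹ dX Y⁻¹ dX) + Tr(Y⁻¹ dY Y⁻¹ dY))`, `τ = X + iY`,
with scale factor `c`, evaluated at `τ` on two tangent vectors. -/
def metric {g : ℕ} (c : ℝ) (τ Z W : Matrix (Fin g) (Fin g) ℂ) : ℝ :=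
  c * (((τ.map Complex.im)⁻¹ * Z.map Complex.re * (τ.map Complex.im)⁻¹ * W.map Complex.re).trace +
    ((τ.map Complex.im)⁻¹ * Z.map Complex.im * (τ.map Complex.im)⁻¹ * W.map Complex.im).trace)

/-- The components `G_{IJ}` of the invariant metric in the coordinates `Re τ_{ij}, Im τ_{ij}`. -/
def gram {g : ℕ} (c : ℝ) (p : CoordIndex g → ℝ) : Matrix (CoordIndex g) (CoordIndex g) ℝ :=
  Matrix.of fun I J => metric c (ofCoords p) (ofCoords (Pi.single I 1)) (ofCoords (Pi.single J 1))

/-- The scale factor `c` is the one for which the Riemannian volume `√G ∏ dX_I` is the invariant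
measure `det(Im τ)^{-(g+1)} ∏_{i ≤ j} d Re τ_{ij} d Im τ_{ij}`. -/
def IsNormalized (g : ℕ) (c : ℝ) : Prop :=
  0 < c ∧ ∀ p ∈ coordDomain g,
    √|(gram c p).det| = (((ofCoords p).map Complex.im).det ^ (g + 1))⁻¹

/-- The partial derivative `∂_I f`. -/
def partialDeriv {ι : Type*} [Fintype ι] [DecidableEq ι] (I : ι) (f : (ι → ℝ) → ℂ)
    (p : ι → ℝ) : ℂ :=
  fderiv ℝ f p (Pi.single I 1)

/-- The Laplacian `- |G|^{-1/2} ∂_I (|G|^{1/2} G^{IJ} ∂_J f)` of a metric `G_{IJ}` given in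
coordinates. -/
def laplaceBeltrami {ι : Type*} [Fintype ι] [DecidableEq ι] (G : (ι → ℝ) → Matrix ι ι ℝ)
    (f : (ι → ℝ) → ℂ) (p : ι → ℝ) : ℂ :=
  -(((√|(G p).det| : ℝ) : ℂ)⁻¹ * ∑ I, ∑ J,
    partialDeriv I
      (fun q => ((√|(G q).det| : ℝ) : ℂ) * (((G q)⁻¹ I J : ℝ) : ℂ) * partialDeriv J f q) p)

/-- The Laplacian of the invariant metric with scale factor `c`, for functions on the Siegel upper
half space. -/
def laplacian {g : ℕ} (c : ℝ) (f : Matrix (Fin g) (Fin g) ℂ → ℂ)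
    (τ : Matrix (Fin g) (Fin g) ℂ) : ℂ :=
  laplaceBeltrami (gram c) (fun p => f (ofCoords p)) (coords τ)

end

end Siegel

/-! Each term of the series is a power of a quadratic form. If `(m, n)` is the first row of the
lower half of `γ` and `τ = X + iY`, then the height of `γ(τ)` is `1 / Q`, where `Q = (Xm + n)ᵀ Y⁻¹
(Xm + n) + mᵀ Y m` (`height_moebius`). Multiplying `γ` on the left by an integral element of the
parabolic subgroup changes this row only by a sign, and the row determines the coset. So the series
runs over distinct nonzero vectors of `ℤ^(2g)`.

Each power `Q^(-s)` is an eigenfunction. In the chosen coordinates the densitized inverse metric is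
divergence free (`sum_fderiv_densInv`), so `Δ = -G^{IJ} ∂_I ∂_J` without first-order terms. The
inverse metric contracts products of matrix entries into entries of `Y`, which gives `G^{IJ} ∂_I Q
∂_J Q = c⁻¹ Q²` and `G^{IJ} ∂_I ∂_J Q = c⁻¹ (g + 1) Q`. Hence `Δ Q^(-s) = -c⁻¹ (s(s + 1) - s(g + 1))
Q^(-s) = c⁻¹ s (g - s) Q^(-s)`. Evaluating the volume condition at `τ = i` gives `c⁻¹ =
2^((g-1)/(g+1))` (`inv_normalization`).

For the sum, write a row as its length times a unit vector. Since `Q` is homogeneous of degree 2,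
the length contributes the weight `‖v‖^(-2s)`, absolutely summable over `ℤ^(2g) \ {0}` when `Re s >
g`. The remaining factor is smooth in the direction and the point, and directions lie in a compact
sphere, so all derivatives are bounded uniformly near a given point and the series may be
differentiated termwise.

For a continuation, derivatives along the coordinates remain holomorphic in `s`
(`differentiableOn_fderivRight`), so both sides of the equation are holomorphic on `U` and the
identity theorem applies. -/

namespace Siegel

/-! ### Coordinates on the Siegel space and the quadratic form of a row. -/

section Coordinates

open scoped ContDiff

/-- The real part of the symmetric matrix with given coordinates. -/
def reMat {g : ℕ} (p : CoordIndex g → ℝ) : Matrix (Fin g) (Fin g) ℝ :=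
  Matrix.of fun i j => p (Sum.inl s(i, j))

/-- The imaginary part of the symmetric matrix with given coordinates. -/
def imMat {g : ℕ} (p : CoordIndex g → ℝ) : Matrix (Fin g) (Fin g) ℝ :=
  Matrix.of fun i j => p (Sum.inr s(i, j))

variable {g : ℕ}

theorem reMat_apply (p : CoordIndex g → ℝ) (i j : Fin g) : reMat p i j = p (Sum.inl s(i, j)) := rfl

theorem imMat_apply (p : CoordIndex g → ℝ) (i j : Fin g) : imMat p i j = p (Sum.inr s(i, j)) := rfl

theorem ofCoords_map_re (p : CoordIndex g → ℝ) : (ofCoords p).map Complex.re = reMat p := by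
  ext i j; simp [ofCoords, reMat]

theorem ofCoords_map_im (p : CoordIndex g → ℝ) : (ofCoords p).map Complex.im = imMat p := by
  ext i j; simp [ofCoords, imMat]

theorem transpose_ofCoords (p : CoordIndex g → ℝ) : (ofCoords p)ᵀ = ofCoords p := by
  ext i j; simp [ofCoords, Sym2.eq_swap]

theorem transpose_imMat (p : CoordIndex g → ℝ) : (imMat p)ᵀ = imMat p := by
  ext i j; simp [imMat, Sym2.eq_swap]

theorem imMat_comm (p : CoordIndex g → ℝ) (i j : Fin g) : imMat p i j = imMat p j i := by
  rw [imMat_apply, imMat_apply, Sym2.eq_swap]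

theorem transpose_inv_imMat (p : CoordIndex g → ℝ) : ((imMat p)⁻¹)ᵀ = (imMat p)⁻¹ := by
  rw [Matrix.transpose_nonsing_inv, transpose_imMat]

theorem mem_coordDomain {p : CoordIndex g → ℝ} : p ∈ coordDomain g ↔ (imMat p).PosDef := by
  change _ ∧ _ ↔ _
  rw [ofCoords_map_im]
  exact and_iff_right (transpose_ofCoords p)

theorem det_imMat_pos {p : CoordIndex g → ℝ} (hp : p ∈ coordDomain g) : 0 < (imMat p).det :=
  (mem_coordDomain.1 hp).det_pos

theorem isUnit_det_imMat {p : CoordIndex g → ℝ} (hp : p ∈ coordDomain g) :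
    IsUnit (imMat p).det := (det_imMat_pos hp).ne'.isUnit

theorem coords_mem_coordDomain {τ : Matrix (Fin g) (Fin g) ℂ} (hτ : τ ∈ upperHalfSpace g) :
    coords τ ∈ coordDomain g := by
  change ofCoords (coords τ) ∈ upperHalfSpace g
  rwa [ofCoords_coords hτ.1]

theorem posDef_iff_dotProduct_pos {A : Matrix (Fin g) (Fin g) ℝ} (hA : Aᵀ = A) :
    A.PosDef ↔ ∀ x ∈ Metric.sphere (0 : Fin g → ℝ) 1, 0 < x ⬝ᵥ A *ᵥ x := by
  rw [posDef_iff_dotProduct_mulVec]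
  constructor
  · rintro ⟨-, h⟩ x hx
    have := @h x (by rintro rfl; simp at hx)
    simpa using this
  · refine fun h => ⟨by rwa [IsHermitian, conjTranspose_eq_transpose_of_trivial], fun x hx => ?_⟩
    have hx' : 0 < ‖x‖ := norm_pos_iff.2 hx
    have h1 := h (‖x‖⁻¹ • x) (by simp [norm_smul, hx'.ne'])
    rw [mulVec_smul, smul_dotProduct, dotProduct_smul, smul_eq_mul, smul_eq_mul] at h1
    have h2 : 0 < ‖x‖⁻¹ := by positivity
    have := pos_of_mul_pos_right (pos_of_mul_pos_right h1 h2.le) h2.le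
    simpa using this

theorem continuous_imMat : Continuous (imMat : (CoordIndex g → ℝ) → _) :=
  continuous_matrix fun _ _ => continuous_apply _

/-- By homogeneity positivity need only be tested on the unit sphere, and compactness of the sphere
lets the strict inequality persist on a neighbourhood. -/
theorem isOpen_coordDomain : IsOpen (coordDomain g) := by
  have h : coordDomain g = {p | ∀ x ∈ Metric.sphere (0 : Fin g → ℝ) 1, 0 < x ⬝ᵥ imMat p *ᵥ x} := by
    ext p
    rw [mem_coordDomain, posDef_iff_dotProduct_pos (transpose_imMat p), Set.mem_ofPred_eq]
  rw [h, isOpen_iff_mem_nhds]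
  intro p hp
  refine (isCompact_sphere (0 : Fin g → ℝ) 1).eventually_forall_of_forall_eventually
    fun x hx => ?_
  have hc : Continuous fun z : (CoordIndex g → ℝ) × (Fin g → ℝ) => z.2 ⬝ᵥ imMat z.1 *ᵥ z.2 :=
    continuous_snd.dotProduct ((continuous_imMat.comp continuous_fst).matrix_mulVec continuous_snd)
  exact hc.continuousAt.eventually (lt_mem_nhds (hp x hx))

theorem contDiff_det {E : Type*} [NormedAddCommGroup E] [NormedSpace ℝ E] {n : WithTop ℕ∞}
    {ι : Type*} [Fintype ι] [DecidableEq ι] {A : E → Matrix ι ι ℝ}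
    (hA : ∀ i j, ContDiff ℝ n fun x => A x i j) : ContDiff ℝ n fun x => (A x).det := by
  simp only [det_apply]
  exact ContDiff.sum fun σ _ => (contDiff_prod fun i _ => hA _ _).const_smul _

theorem contDiff_adjugate {E : Type*} [NormedAddCommGroup E] [NormedSpace ℝ E] {n : WithTop ℕ∞}
    {ι : Type*} [Fintype ι] [DecidableEq ι] {A : E → Matrix ι ι ℝ}
    (hA : ∀ i j, ContDiff ℝ n fun x => A x i j) (i j : ι) :
    ContDiff ℝ n fun x => (A x).adjugate i j := by
  simp only [adjugate_apply]
  refine contDiff_det fun k l => ?_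
  simp only [updateRow_apply]
  split_ifs
  · exact contDiff_const
  · exact hA k l

theorem contDiff_imMat (i j : Fin g) {n : WithTop ℕ∞} :
    ContDiff ℝ n fun p : CoordIndex g → ℝ => imMat p i j := contDiff_apply ℝ ℝ _

theorem contDiff_det_imMat {n : WithTop ℕ∞} :
    ContDiff ℝ n fun p : CoordIndex g → ℝ => (imMat p).det :=
  contDiff_det fun i j => contDiff_imMat i j

theorem contDiffAt_inv_imMat {p : CoordIndex g → ℝ} (hp : p ∈ coordDomain g) (i j : Fin g)
    {n : WithTop ℕ∞} : ContDiffAt ℝ n (fun q : CoordIndex g → ℝ => (imMat q)⁻¹ i j) p := by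
  simp only [inv_def, Ring.inverse_eq_inv', Matrix.smul_apply, smul_eq_mul]
  exact (contDiff_det_imMat.contDiffAt.inv (det_imMat_pos hp).ne').mul
    (contDiff_adjugate (fun i j => contDiff_imMat i j) i j).contDiffAt

/-- The vector `Xm + n` attached to a vector `v = (m, n)`. -/
def affVec (v : Fin g ⊕ Fin g → ℝ) (p : CoordIndex g → ℝ) : Fin g → ℝ :=
  reMat p *ᵥ (v ∘ Sum.inl) + v ∘ Sum.inr

/-- The vector `Y⁻¹(Xm + n)` attached to a vector `v = (m, n)`. -/
noncomputable def invVec (v : Fin g ⊕ Fin g → ℝ) (p : CoordIndex g → ℝ) : Fin g → ℝ :=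
  (imMat p)⁻¹ *ᵥ affVec v p

/-- The quadratic form `(Xm + n)ᵀ Y⁻¹ (Xm + n) + mᵀ Y m` in `v = (m, n)`. -/
noncomputable def quadForm (v : Fin g ⊕ Fin g → ℝ) (p : CoordIndex g → ℝ) : ℝ :=
  affVec v p ⬝ᵥ invVec v p + (v ∘ Sum.inl) ⬝ᵥ imMat p *ᵥ (v ∘ Sum.inl)

theorem quadForm_smul (r : ℝ) (v : Fin g ⊕ Fin g → ℝ) (p : CoordIndex g → ℝ) :
    quadForm (r • v) p = r ^ 2 * quadForm v p := by
  have h1 : (r • v) ∘ Sum.inl = r • (v ∘ Sum.inl) := rfl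
  have h2 : (r • v) ∘ Sum.inr = r • (v ∘ Sum.inr) := rfl
  simp only [quadForm, invVec, affVec, h1, h2, mulVec_smul, ← smul_add, smul_dotProduct,
    dotProduct_smul, smul_eq_mul]
  ring

/-- Both summands are nonnegative. If `m ≠ 0` the second is positive; if `m = 0` then `Xm + n = n ≠
0` and the first is. -/
theorem quadForm_pos {v : Fin g ⊕ Fin g → ℝ} (hv : v ≠ 0) {p : CoordIndex g → ℝ}
    (hp : p ∈ coordDomain g) : 0 < quadForm v p := by
  have hY := mem_coordDomain.1 hp
  have h1 : 0 ≤ affVec v p ⬝ᵥ invVec v p := by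
    simpa [invVec] using hY.inv.posSemidef.dotProduct_mulVec_nonneg (affVec v p)
  by_cases hm : v ∘ Sum.inl = 0
  · have hn : affVec v p ≠ 0 := by
      intro h0
      apply hv
      rw [affVec, hm, mulVec_zero, zero_add] at h0
      ext (i | i)
      · exact congrFun hm i
      · exact congrFun h0 i
    have := hY.inv.dotProduct_mulVec_pos hn
    simpa [quadForm, hm, invVec] using this
  · have := hY.dotProduct_mulVec_pos hm
    rw [star_trivial] at this
    exact add_pos_of_nonneg_of_pos h1 this

theorem contDiffAt_affVec (q : (Fin g ⊕ Fin g → ℝ) × (CoordIndex g → ℝ)) (i : Fin g)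
    {n : WithTop ℕ∞} : ContDiffAt ℝ n
      (fun q : (Fin g ⊕ Fin g → ℝ) × (CoordIndex g → ℝ) => affVec q.1 q.2 i) q := by
  simp only [affVec, mulVec, dotProduct, Pi.add_apply, Function.comp, reMat_apply]
  fun_prop

theorem contDiffAt_invVec {q : (Fin g ⊕ Fin g → ℝ) × (CoordIndex g → ℝ)}
    (hq : q.2 ∈ coordDomain g) (i : Fin g) {n : WithTop ℕ∞} : ContDiffAt ℝ n
      (fun q : (Fin g ⊕ Fin g → ℝ) × (CoordIndex g → ℝ) => invVec q.1 q.2 i) q := by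
  simp only [invVec, mulVec, dotProduct]
  exact ContDiffAt.sum fun j _ => ((contDiffAt_inv_imMat hq i j).comp q contDiffAt_snd).mul
    (contDiffAt_affVec q j)

theorem contDiffAt_quadForm {q : (Fin g ⊕ Fin g → ℝ) × (CoordIndex g → ℝ)}
    (hq : q.2 ∈ coordDomain g) {n : WithTop ℕ∞} : ContDiffAt ℝ n
      (fun q : (Fin g ⊕ Fin g → ℝ) × (CoordIndex g → ℝ) => quadForm q.1 q.2) q := by
  simp only [quadForm, dotProduct]
  refine (ContDiffAt.sum fun i _ => (contDiffAt_affVec q i).mul (contDiffAt_invVec hq i)).add ?_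
  simp only [mulVec, dotProduct, Function.comp, imMat_apply]
  fun_prop

theorem contDiffAt_invVec_right (v : Fin g ⊕ Fin g → ℝ) {p : CoordIndex g → ℝ}
    (hp : p ∈ coordDomain g) (i : Fin g) {n : WithTop ℕ∞} :
    ContDiffAt ℝ n (fun q => invVec v q i) p :=
  ContDiffAt.comp (f := fun q => (v, q)) p (contDiffAt_invVec (q := (v, p)) hp i) (by fun_prop)

theorem contDiffAt_quadForm_right (v : Fin g ⊕ Fin g → ℝ) {p : CoordIndex g → ℝ}
    (hp : p ∈ coordDomain g) {n : WithTop ℕ∞} : ContDiffAt ℝ n (quadForm v) p :=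
  ContDiffAt.comp (f := fun q => (v, q)) p (contDiffAt_quadForm (q := (v, p)) hp) (by fun_prop)

end Coordinates

/-! ### First and second derivatives of the quadratic form. -/

section QuadFormDerivatives

variable {g : ℕ}

theorem reMat_add_smul (p h : CoordIndex g → ℝ) (t : ℝ) :
    reMat (p + t • h) = reMat p + t • reMat h := rfl

theorem imMat_add_smul (p h : CoordIndex g → ℝ) (t : ℝ) :
    imMat (p + t • h) = imMat p + t • imMat h := rfl

theorem hasLineDerivAt_imMat (p h : CoordIndex g → ℝ) (i j : Fin g) :
    HasLineDerivAt ℝ (fun q => imMat q i j) (imMat h i j) p h := by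
  change HasDerivAt (fun t : ℝ => imMat p i j + t * imMat h i j) _ 0
  simpa using ((hasDerivAt_id (0 : ℝ)).mul_const (imMat h i j)).const_add (imMat p i j)

theorem hasLineDerivAt_affVec (v : Fin g ⊕ Fin g → ℝ) (p h : CoordIndex g → ℝ) (i : Fin g) :
    HasLineDerivAt ℝ (fun q => affVec v q i) ((reMat h *ᵥ (v ∘ Sum.inl)) i) p h := by
  have : ∀ t : ℝ, affVec v (p + t • h) i = affVec v p i + t * (reMat h *ᵥ (v ∘ Sum.inl)) i := by
    intro t
    simp only [affVec, reMat_add_smul, add_mulVec, smul_mulVec, Pi.add_apply, Pi.smul_apply,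
      smul_eq_mul]
    ring
  simp only [HasLineDerivAt, this]
  simpa using ((hasDerivAt_id (0 : ℝ)).mul_const
    ((reMat h *ᵥ (v ∘ Sum.inl)) i)).const_add (affVec v p i)

theorem hasLineDerivAt_mul {E : Type*} [NormedAddCommGroup E] [NormedSpace ℝ E] {f f₁ : E → ℝ}
    {a b : ℝ} {p h : E} (hf : HasLineDerivAt ℝ f a p h) (hf₁ : HasLineDerivAt ℝ f₁ b p h) :
    HasLineDerivAt ℝ (fun q => f q * f₁ q) (a * f₁ p + f p * b) p h := by
  simpa [HasLineDerivAt] using HasDerivAt.fun_mul hf hf₁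

theorem hasLineDerivAt_sum {E ι : Type*} [NormedAddCommGroup E] [NormedSpace ℝ E] [Fintype ι]
    {f : ι → E → ℝ} {a : ι → ℝ} {p h : E} (hf : ∀ i, HasLineDerivAt ℝ (f i) (a i) p h) :
    HasLineDerivAt ℝ (fun q => ∑ i, f i q) (∑ i, a i) p h := by
  exact HasDerivAt.fun_sum fun i _ => hf i

theorem hasLineDerivAt_dotProduct {E ι : Type*} [NormedAddCommGroup E] [NormedSpace ℝ E]
    [Fintype ι] {f f₁ : E → ι → ℝ} {a b : ι → ℝ} {p h : E}
    (hf : ∀ i, HasLineDerivAt ℝ (fun q => f q i) (a i) p h)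
    (hf₁ : ∀ i, HasLineDerivAt ℝ (fun q => f₁ q i) (b i) p h) :
    HasLineDerivAt ℝ (fun q => f q ⬝ᵥ f₁ q) (a ⬝ᵥ f₁ p + f p ⬝ᵥ b) p h := by
  rw [dotProduct, dotProduct, ← Finset.sum_add_distrib]
  exact hasLineDerivAt_sum fun i => hasLineDerivAt_mul (hf i) (hf₁ i)

theorem hasLineDerivAt_const {E : Type*} [NormedAddCommGroup E] [NormedSpace ℝ E] (a : ℝ)
    (p h : E) : HasLineDerivAt ℝ (fun _ : E => a) 0 p h := hasDerivAt_const _ _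

theorem hasLineDerivAt_mulVec {E ι : Type*} [NormedAddCommGroup E] [NormedSpace ℝ E]
    [Fintype ι] {A : E → Matrix ι ι ℝ} {f : E → ι → ℝ} {A' : Matrix ι ι ℝ} {b : ι → ℝ} {p h : E}
    (hA : ∀ i j, HasLineDerivAt ℝ (fun q => A q i j) (A' i j) p h)
    (hf : ∀ i, HasLineDerivAt ℝ (fun q => f q i) (b i) p h) (i : ι) :
    HasLineDerivAt ℝ (fun q => (A q *ᵥ f q) i) ((A' *ᵥ f p + A p *ᵥ b) i) p h :=
  hasLineDerivAt_dotProduct (hA i) hf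

/-- The vector `Xₕ m - Yₕ Y⁻¹(Xm + n)` attached to `v = (m, n)` and to a direction `h`. -/
noncomputable def tangentVec (v : Fin g ⊕ Fin g → ℝ) (p h : CoordIndex g → ℝ) : Fin g → ℝ :=
  reMat h *ᵥ (v ∘ Sum.inl) - imMat h *ᵥ invVec v p

theorem imMat_mulVec_invVec (v : Fin g ⊕ Fin g → ℝ) {p : CoordIndex g → ℝ}
    (hp : p ∈ coordDomain g) : imMat p *ᵥ invVec v p = affVec v p := by
  rw [invVec, mulVec_mulVec, mul_nonsing_inv _ (isUnit_det_imMat hp), one_mulVec]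

/-- Differentiating the relation `Yω = Xm + n` for `ω = invVec v` and solving for the derivative of
`ω` avoids differentiating `Y⁻¹` entrywise; smoothness of `ω` is already known. -/
theorem hasLineDerivAt_invVec (v : Fin g ⊕ Fin g → ℝ) {p : CoordIndex g → ℝ}
    (hp : p ∈ coordDomain g) (h : CoordIndex g → ℝ) (i : Fin g) :
    HasLineDerivAt ℝ (fun q => invVec v q i) (((imMat p)⁻¹ *ᵥ tangentVec v p h) i) p h := by
  have hd : ∀ i, HasLineDerivAt ℝ (fun q => invVec v q i)
      (fderiv ℝ (fun q => invVec v q i) p h) p h := fun i =>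
    (((contDiffAt_invVec_right v hp i (n := 1)).differentiableAt
      one_ne_zero).hasFDerivAt).hasLineDerivAt h
  set b : Fin g → ℝ := fun i => fderiv ℝ (fun q => invVec v q i) p h with hb
  have key : imMat h *ᵥ invVec v p + imMat p *ᵥ b = reMat h *ᵥ (v ∘ Sum.inl) := by
    ext i
    have h1 := hasLineDerivAt_mulVec (hasLineDerivAt_imMat p h) hd i
    have h2 := (hasLineDerivAt_affVec v p h i).congr_of_eventuallyEq
      (f₁ := fun q => (imMat q *ᵥ invVec v q) i) (by
        filter_upwards [isOpen_coordDomain.mem_nhds hp] with q hq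
        rw [imMat_mulVec_invVec v hq])
    exact h1.unique h2
  have hb' : b = (imMat p)⁻¹ *ᵥ tangentVec v p h := by
    rw [tangentVec, ← key, add_sub_cancel_left, mulVec_mulVec,
      nonsing_inv_mul _ (isUnit_det_imMat hp), one_mulVec]
  rw [← hb']
  exact hd i

theorem inv_imMat_mulVec_dotProduct (p : CoordIndex g → ℝ) (a b : Fin g → ℝ) :
    a ⬝ᵥ (imMat p)⁻¹ *ᵥ b = ((imMat p)⁻¹ *ᵥ a) ⬝ᵥ b := by
  rw [dotProduct_mulVec, ← mulVec_transpose, transpose_inv_imMat]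

theorem imMat_mulVec_dotProduct (p : CoordIndex g → ℝ) (a b : Fin g → ℝ) :
    a ⬝ᵥ imMat p *ᵥ b = (imMat p *ᵥ a) ⬝ᵥ b := by
  rw [dotProduct_mulVec, ← mulVec_transpose, transpose_imMat]

theorem fderiv_quadForm (v : Fin g ⊕ Fin g → ℝ) {p : CoordIndex g → ℝ}
    (hp : p ∈ coordDomain g) (h : CoordIndex g → ℝ) :
    fderiv ℝ (quadForm v) p h = 2 * (invVec v p ⬝ᵥ reMat h *ᵥ (v ∘ Sum.inl)) -
      invVec v p ⬝ᵥ imMat h *ᵥ invVec v p + (v ∘ Sum.inl) ⬝ᵥ imMat h *ᵥ (v ∘ Sum.inl) := by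
  have h1 := ((contDiffAt_quadForm_right v hp (n := 1)).differentiableAt
    one_ne_zero).hasFDerivAt.hasLineDerivAt h
  have h2 : HasLineDerivAt ℝ (quadForm v) _ p h := HasDerivAt.add
    (hasLineDerivAt_dotProduct (hasLineDerivAt_affVec v p h) (hasLineDerivAt_invVec v hp h))
    (hasLineDerivAt_dotProduct (fun i => hasLineDerivAt_const ((v ∘ Sum.inl) i) p h)
      (hasLineDerivAt_mulVec (hasLineDerivAt_imMat p h)
        (fun i => hasLineDerivAt_const ((v ∘ Sum.inl) i) p h)))
  rw [h1.unique h2, inv_imMat_mulVec_dotProduct, ← invVec, tangentVec, dotProduct_sub,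
    dotProduct_comm (reMat h *ᵥ _)]
  have : (fun _ => 0 : Fin g → ℝ) = 0 := rfl
  simp only [this, zero_dotProduct, mulVec_zero, add_zero, zero_add]
  ring

/-- In the first derivative only `ω = invVec v` depends on the point, so the rule for `dω` suffices.
By symmetry of the direction's imaginary part the terms combine into one pairing of tangent vectors.
-/
theorem fderiv_fderiv_quadForm (v : Fin g ⊕ Fin g → ℝ) {p : CoordIndex g → ℝ}
    (hp : p ∈ coordDomain g) (h k : CoordIndex g → ℝ) :
    fderiv ℝ (fun q => fderiv ℝ (quadForm v) q h) p k =
      2 * (tangentVec v p h ⬝ᵥ (imMat p)⁻¹ *ᵥ tangentVec v p k) := by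
  have h0 : DifferentiableAt ℝ (fun q => fderiv ℝ (quadForm v) q h) p :=
    (((contDiffAt_quadForm_right v hp (n := 2)).fderiv_right (m := 1) le_rfl).clm_apply
      contDiffAt_const).differentiableAt one_ne_zero
  have h1 := h0.hasFDerivAt.hasLineDerivAt k
  have hT : ∀ a : Fin g → ℝ, a ⬝ᵥ imMat h *ᵥ invVec v p = invVec v p ⬝ᵥ imMat h *ᵥ a :=
    fun a => by rw [imMat_mulVec_dotProduct, dotProduct_comm]
  have hω := hasLineDerivAt_invVec v hp k
  have h2 : HasLineDerivAt ℝ (fun q => 2 * (invVec v q ⬝ᵥ reMat h *ᵥ (v ∘ Sum.inl)) -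
      invVec v q ⬝ᵥ imMat h *ᵥ invVec v q + (v ∘ Sum.inl) ⬝ᵥ imMat h *ᵥ (v ∘ Sum.inl)) _ p k :=
    HasDerivAt.add_const _ <| HasDerivAt.sub
      (HasDerivAt.const_mul 2 <| hasLineDerivAt_dotProduct hω
        fun i => hasLineDerivAt_const ((reMat h *ᵥ (v ∘ Sum.inl)) i) p k)
      (hasLineDerivAt_dotProduct hω <| hasLineDerivAt_mulVec (A' := 0)
        (fun i j => hasLineDerivAt_const (imMat h i j) p k) hω)
  have h3 := h2.congr_of_eventuallyEq (f₁ := fun q => fderiv ℝ (quadForm v) q h) (by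
    filter_upwards [isOpen_coordDomain.mem_nhds hp] with q hq
    rw [fderiv_quadForm v hq])
  have e1 : (fun _ => 0 : Fin g → ℝ) = 0 := rfl
  rw [h1.unique h3]
  simp only [e1, dotProduct_zero, add_zero, zero_mulVec, zero_add, hT]
  set b := (imMat p)⁻¹ *ᵥ tangentVec v p k
  rw [tangentVec, sub_dotProduct, dotProduct_comm b, imMat_mulVec_dotProduct]
  ring

end QuadFormDerivatives

/-! ### The inverse metric and its contraction rules. -/

section InverseGram

variable {g : ℕ}

/-- The symmetric matrix with entries `1` at the positions `(i, j)` with `s(i, j) = z`. -/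
def symUnit (z : Sym2 (Fin g)) : Matrix (Fin g) (Fin g) ℝ :=
  Matrix.of fun i j => if s(i, j) = z then 1 else 0

theorem symUnit_apply (z : Sym2 (Fin g)) (i j : Fin g) :
    symUnit z i j = if s(i, j) = z then 1 else 0 := rfl

theorem sum_symUnit (ψ : Sym2 (Fin g) → ℝ) (i j : Fin g) :
    ∑ z, symUnit z i j * ψ z = ψ s(i, j) := by
  simp [symUnit_apply]

theorem reMat_single_inl (z : Sym2 (Fin g)) : reMat (Pi.single (Sum.inl z) 1) = symUnit z := by
  ext i j; simp [reMat_apply, symUnit_apply, Pi.single_apply]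

theorem reMat_single_inr (z : Sym2 (Fin g)) : reMat (Pi.single (Sum.inr z) 1) = 0 := by
  ext i j; simp [reMat_apply]

theorem imMat_single_inl (z : Sym2 (Fin g)) : imMat (Pi.single (Sum.inl z) 1) = 0 := by
  ext i j; simp [imMat_apply]

theorem imMat_single_inr (z : Sym2 (Fin g)) : imMat (Pi.single (Sum.inr z) 1) = symUnit z := by
  ext i j; simp [imMat_apply, symUnit_apply, Pi.single_apply]

/-- The diagonal block of the Gram matrix of the invariant metric. -/
noncomputable def gramBlock (c : ℝ) (p : CoordIndex g → ℝ) : Matrix (Sym2 (Fin g)) (Sym2 (Fin g)) ℝ :=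
  Matrix.of fun z w => c * ((imMat p)⁻¹ * symUnit z * (imMat p)⁻¹ * symUnit w).trace

/-- The diagonal block of the inverse of the Gram matrix of the invariant metric. -/
noncomputable def invGramBlock (c : ℝ) (p : CoordIndex g → ℝ) :
    Matrix (Sym2 (Fin g)) (Sym2 (Fin g)) ℝ :=
  Matrix.of fun z w => (2 * c)⁻¹ * (imMat p z.inf w.inf * imMat p z.sup w.sup +
    imMat p z.inf w.sup * imMat p z.sup w.inf)

/-- The expression is symmetric under swapping within either pair, so the ordered representatives in
the definition can be replaced by arbitrary ones. -/
theorem invGramBlock_mk (c : ℝ) (p : CoordIndex g → ℝ) (i j k l : Fin g) :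
    invGramBlock c p s(i, j) s(k, l) =
      (2 * c)⁻¹ * (imMat p i k * imMat p j l + imMat p i l * imMat p j k) := by
  simp only [invGramBlock, Matrix.of_apply, Sym2.inf_mk, Sym2.sup_mk]
  rcases le_total i j with h | h <;> rcases le_total k l with h' | h' <;>
  simp only [h, h', inf_of_le_left, inf_of_le_right, sup_of_le_left, sup_of_le_right] <;> ring

theorem gram_eq_fromBlocks (c : ℝ) (p : CoordIndex g → ℝ) :
    gram c p = fromBlocks (gramBlock c p) 0 0 (gramBlock c p) := by
  ext (z | z) (w | w) <;>
  simp [gram, metric, gramBlock, ofCoords_map_re, ofCoords_map_im, reMat_single_inl,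
    reMat_single_inr, imMat_single_inl, imMat_single_inr]

/-- The basic contraction: up to scale the inverse metric acts as `M ↦ YMY`, symmetrized. It yields
the inverse of the Gram matrix, the divergence computation and the rank-one rule below. -/
theorem sum_symUnit_mul_invGramBlock (c : ℝ) (p : CoordIndex g → ℝ) (M : Matrix (Fin g) (Fin g) ℝ)
    (k l : Fin g) :
    ∑ z, (∑ i, ∑ j, symUnit z i j * M i j) * invGramBlock c p z s(k, l) =
      (2 * c)⁻¹ * ((imMat p * M * imMat p) k l + (imMat p * M * imMat p) l k) := by
  have h1 : ∀ i j, ∑ z, symUnit z i j * M i j * invGramBlock c p z s(k, l) =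
      M i j * invGramBlock c p s(i, j) s(k, l) := by
    intro i j
    rw [← sum_symUnit (fun z => invGramBlock c p z s(k, l)) i j, Finset.mul_sum]
    exact Finset.sum_congr rfl fun z _ => by ring
  simp only [Finset.sum_mul]
  rw [Finset.sum_comm]
  simp_rw [Finset.sum_comm (s := Finset.univ (α := Sym2 (Fin g))), h1, invGramBlock_mk,
    mul_apply, Finset.sum_mul]
  rw [Finset.sum_comm (f := fun x y => imMat p k y * M y x * imMat p x l),
    Finset.sum_comm (f := fun x y => imMat p l y * M y x * imMat p x k),
    ← Finset.sum_add_distrib, Finset.mul_sum]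
  refine Finset.sum_congr rfl fun i _ => ?_
  rw [← Finset.sum_add_distrib, Finset.mul_sum]
  refine Finset.sum_congr rfl fun j _ => ?_
  rw [imMat_comm p k i, imMat_comm p l i]
  ring

theorem invGramBlock_comm (c : ℝ) (p : CoordIndex g → ℝ) (z w : Sym2 (Fin g)) :
    invGramBlock c p z w = invGramBlock c p w z := by
  induction z, w using Sym2.inductionOn₂ with
  | _ i j k l =>
    rw [invGramBlock_mk, invGramBlock_mk, imMat_comm p i k, imMat_comm p j l, imMat_comm p i l,
      imMat_comm p j k]
    ring

theorem invGramBlock_mul_gramBlock {c : ℝ} (hc : c ≠ 0) {p : CoordIndex g → ℝ}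
    (hp : p ∈ coordDomain g) : invGramBlock c p * gramBlock c p = 1 := by
  ext z v
  induction z with
  | _ k l =>
    have hu := isUnit_det_imMat hp
    have h1 : ∀ z, gramBlock c p z v = c * ∑ i, ∑ j, symUnit z i j *
        ((imMat p)⁻¹ * symUnit v * (imMat p)⁻¹)ᵀ i j := by
      intro z
      rw [gramBlock, Matrix.of_apply, Matrix.mul_assoc, Matrix.mul_assoc, trace_mul_comm,
        Matrix.mul_assoc]
      simp only [trace, diag_apply, Matrix.mul_apply (M := symUnit z), transpose_apply, Matrix.mul_assoc]
    -- The metric acts by `M ↦ Y⁻¹MY⁻¹`, which `M ↦ YMY` undoes; the two symmetrized terms then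
    -- agree and cancel the `2` in `(2 * c)⁻¹`.
    have h2 : imMat p * ((imMat p)⁻¹ * symUnit v * (imMat p)⁻¹)ᵀ * imMat p = (symUnit v)ᵀ := by
      rw [transpose_mul, transpose_mul, transpose_inv_imMat, ← Matrix.mul_assoc,
        mul_nonsing_inv _ hu, Matrix.one_mul, Matrix.mul_assoc, nonsing_inv_mul _ hu,
        Matrix.mul_one]
    have h3 := sum_symUnit_mul_invGramBlock c p ((imMat p)⁻¹ * symUnit v * (imMat p)⁻¹)ᵀ k l
    rw [h2] at h3
    have h4 : (invGramBlock c p * gramBlock c p) s(k, l) v = c * ((2 * c)⁻¹ *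
        ((symUnit v)ᵀ k l + (symUnit v)ᵀ l k)) := by
      rw [← h3, mul_apply, Finset.mul_sum]
      refine Finset.sum_congr rfl fun z _ => ?_
      rw [h1, invGramBlock_comm]
      ring
    rw [h4, transpose_apply, transpose_apply, symUnit_apply, symUnit_apply, Sym2.eq_swap,
      one_apply]
    split_ifs
    · field_simp; norm_num
    · simp

theorem inv_gram {c : ℝ} (hc : c ≠ 0) {p : CoordIndex g → ℝ} (hp : p ∈ coordDomain g) :
    (gram c p)⁻¹ = fromBlocks (invGramBlock c p) 0 0 (invGramBlock c p) := by
  refine inv_eq_left_inv ?_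
  rw [gram_eq_fromBlocks, fromBlocks_multiply]
  simp [invGramBlock_mul_gramBlock hc hp]

/-- The contraction rule for the rank-one matrix `a bᵀ`, paired with `a'` and `b'`. -/
theorem sum_sum_invGramBlock (c : ℝ) (p : CoordIndex g → ℝ) (a b a' b' : Fin g → ℝ) :
    ∑ z, ∑ w, invGramBlock c p z w * ((a ⬝ᵥ symUnit z *ᵥ b) * (a' ⬝ᵥ symUnit w *ᵥ b')) =
      (2 * c)⁻¹ * ((a ⬝ᵥ imMat p *ᵥ a') * (b ⬝ᵥ imMat p *ᵥ b') +
        (a ⬝ᵥ imMat p *ᵥ b') * (b ⬝ᵥ imMat p *ᵥ a')) := by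
  have hab : ∀ z : Sym2 (Fin g), ∀ a b : Fin g → ℝ, a ⬝ᵥ symUnit z *ᵥ b =
      ∑ i, ∑ j, symUnit z i j * vecMulVec a b i j := by
    intro z a b
    simp only [dotProduct, mulVec, vecMulVec_apply, Finset.mul_sum]
    exact Finset.sum_congr rfl fun i _ => Finset.sum_congr rfl fun j _ => by ring
  have h1 : ∀ w, ∑ z, invGramBlock c p z w * ((a ⬝ᵥ symUnit z *ᵥ b) * (a' ⬝ᵥ symUnit w *ᵥ b')) =
      ∑ k, ∑ l, symUnit w k l * (a' k * b' l * ∑ z, (a ⬝ᵥ symUnit z *ᵥ b) * invGramBlock c p z w) := by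
    intro w
    have : ∀ z, invGramBlock c p z w * ((a ⬝ᵥ symUnit z *ᵥ b) * (a' ⬝ᵥ symUnit w *ᵥ b')) =
      (a' ⬝ᵥ symUnit w *ᵥ b') * ((a ⬝ᵥ symUnit z *ᵥ b) * invGramBlock c p z w) := fun z => by ring
    simp_rw [this]
    rw [← Finset.mul_sum, hab w, Finset.sum_mul]
    refine Finset.sum_congr rfl fun i _ => ?_
    rw [Finset.sum_mul]
    refine Finset.sum_congr rfl fun j _ => ?_
    rw [vecMulVec_apply]
    ring
  rw [Finset.sum_comm]
  simp_rw [h1]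
  rw [Finset.sum_comm]
  simp_rw [Finset.sum_comm (s := Finset.univ (α := Sym2 (Fin g))), sum_symUnit, hab _ a b,
    sum_symUnit_mul_invGramBlock, mul_vecMulVec, vecMulVec_mul, vecMulVec_apply]
  have hv : ∀ x : Fin g → ℝ, x ᵥ* imMat p = imMat p *ᵥ x := fun x => by
    rw [← mulVec_transpose, transpose_imMat]
  simp only [hv]
  rw [imMat_mulVec_dotProduct p a a', imMat_mulVec_dotProduct p b b',
    imMat_mulVec_dotProduct p a b', imMat_mulVec_dotProduct p b a']
  simp only [dotProduct, Finset.sum_mul_sum]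
  rw [Finset.sum_comm (f := fun i j => (imMat p *ᵥ a) i * b' i * ((imMat p *ᵥ b) j * a' j)),
    ← Finset.sum_add_distrib, Finset.mul_sum]
  refine Finset.sum_congr rfl fun i _ => ?_
  rw [← Finset.sum_add_distrib, Finset.mul_sum]
  refine Finset.sum_congr rfl fun j _ => ?_
  ring

end InverseGram

/-! ### The Laplacian without first-order terms, and the normalization constant. -/

section LaplacianFormula

variable {g : ℕ}

/-- Jacobi's formula, read off from `det (1 + tM) = 1 + t tr M + O(t²)` with `M = Y⁻¹ Yₕ`. -/
theorem hasLineDerivAt_det_imMat {p : CoordIndex g → ℝ} (hp : p ∈ coordDomain g)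
    (h : CoordIndex g → ℝ) :
    HasLineDerivAt ℝ (fun q => (imMat q).det)
      ((imMat p).det * ((imMat p)⁻¹ * imMat h).trace) p h := by
  set M := (imMat p)⁻¹ * imMat h with hM
  have h1 : ∀ t : ℝ, (imMat (p + t • h)).det = (imMat p).det * (1 + M.trace * t +
      (Polynomial.eval t (det (1 + (Polynomial.X : Polynomial ℝ) • M.map Polynomial.C)).divX.divX) *
        t ^ 2) := by
    intro t
    rw [← det_one_add_smul, ← det_mul, Matrix.mul_add, Matrix.mul_one, Matrix.mul_smul, hM,
      mul_nonsing_inv_cancel_left _ _ (isUnit_det_imMat hp), imMat_add_smul]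
  simp only [HasLineDerivAt, h1]
  set P := (det (1 + (Polynomial.X : Polynomial ℝ) • M.map Polynomial.C)).divX.divX
  have h2 := ((((hasDerivAt_id (0 : ℝ)).const_mul M.trace).const_add 1).add
    ((P.hasDerivAt 0).mul ((hasDerivAt_id (0 : ℝ)).pow 2))).const_mul (imMat p).det
  simpa using h2

theorem hasLineDerivAt_inv_det_pow {p : CoordIndex g → ℝ} (hp : p ∈ coordDomain g)
    (h : CoordIndex g → ℝ) (n : ℕ) :
    HasLineDerivAt ℝ (fun q => ((imMat q).det ^ n)⁻¹)
      (-(n * ((imMat p).det ^ n)⁻¹ * ((imMat p)⁻¹ * imMat h).trace)) p h := by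
  have hd := (det_imMat_pos hp).ne'
  have h1 : HasLineDerivAt ℝ (fun q => ((imMat q).det ^ n)⁻¹) _ p h :=
    HasDerivAt.fun_inv (HasDerivAt.fun_pow (hasLineDerivAt_det_imMat hp h) n) (by simpa using fun h => absurd h hd)
  convert h1 using 1
  simp only [zero_smul, add_zero]
  rcases n with _ | n
  · simp
  · simp only [Nat.add_sub_cancel, pow_succ]
    field_simp

/-- The number of times that `k` occurs in the unordered pair `z`. -/
def multiplicity (k : Fin g) (z : Sym2 (Fin g)) : ℝ := ∑ x, symUnit z k x + symUnit z k k

/-- There are `g` unordered pairs containing `k`, and `{k, k}` counts twice. This `g + 1` matches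
the exponent of `det Y` in the volume density. -/
theorem sum_multiplicity (k : Fin g) : ∑ z, multiplicity k z = g + 1 := by
  have h : ∀ i j : Fin g, ∑ z, symUnit z i j = 1 := fun i j => by simp [symUnit_apply]
  simp only [multiplicity, Finset.sum_add_distrib, h]
  rw [Finset.sum_comm]
  simp [h]

theorem multiplicity_mk (k i j : Fin g) :
    multiplicity k s(i, j) = (if k = i then 1 else 0) + (if k = j then 1 else 0) := by
  simp only [multiplicity, symUnit_apply, Sym2.eq_iff]
  by_cases h1 : k = i <;> by_cases h2 : k = j
  · subst h1; subst h2; simp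
  · subst h1; simp [h2]
  · subst h2; simp [h1]
  · simp [h1, h2]

theorem hasLineDerivAt_invGramBlock (c : ℝ) (p h : CoordIndex g → ℝ) (i j k l : Fin g) :
    HasLineDerivAt ℝ (fun q => invGramBlock c q s(i, j) s(k, l)) ((2 * c)⁻¹ *
      ((imMat h i k * imMat p j l + imMat p i k * imMat h j l) +
        (imMat h i l * imMat p j k + imMat p i l * imMat h j k))) p h := by
  simp only [invGramBlock_mk]
  exact HasDerivAt.const_mul _ (HasDerivAt.add
    (hasLineDerivAt_mul (hasLineDerivAt_imMat p h i k) (hasLineDerivAt_imMat p h j l))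
    (hasLineDerivAt_mul (hasLineDerivAt_imMat p h i l) (hasLineDerivAt_imMat p h j k)))

theorem hasLineDerivAt_invGramBlock_diag (c : ℝ) (p : CoordIndex g → ℝ) (z : Sym2 (Fin g))
    (k l : Fin g) :
    HasLineDerivAt ℝ (fun q => invGramBlock c q z s(k, l))
      ((2 * c)⁻¹ * (imMat p k l * (multiplicity k z + multiplicity l z))) p
      (Pi.single (Sum.inr z) 1) := by
  induction z with
  | _ i j =>
    convert hasLineDerivAt_invGramBlock c p (Pi.single (Sum.inr s(i, j)) 1) i j k l using 2
    have e1 : ∀ a, (symUnit s(i, j) i a : ℝ) = if a = j then 1 else 0 := by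
      intro a; rw [symUnit_apply]; simp only [Sym2.congr_right]
    have e2 : ∀ a, (symUnit s(i, j) j a : ℝ) = if a = i then 1 else 0 := by
      intro a; rw [symUnit_apply, Sym2.eq_swap (a := i)]; simp only [Sym2.congr_right]
    rw [imMat_single_inr, multiplicity_mk, multiplicity_mk, e1, e2, e1, e2]
    have h1 : (if k = j then (1 : ℝ) else 0) * imMat p j l =
        (if k = j then 1 else 0) * imMat p k l := by
      split_ifs with h <;> simp [h]
    have h2 : imMat p i k * (if l = i then (1 : ℝ) else 0) =
        (if l = i then 1 else 0) * imMat p k l := by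
      split_ifs with h
      · rw [h, imMat_comm]; ring
      · simp
    have h3 : (if l = j then (1 : ℝ) else 0) * imMat p j k =
        (if l = j then 1 else 0) * imMat p k l := by
      split_ifs with h
      · rw [← h, imMat_comm]
      · simp
    have h4 : imMat p i l * (if k = i then (1 : ℝ) else 0) =
        (if k = i then 1 else 0) * imMat p k l := by
      split_ifs with h <;> simp [h]
    rw [h1, h2, h3, h4]
    ring

theorem contDiff_invGramBlock (c : ℝ) (z w : Sym2 (Fin g)) {n : WithTop ℕ∞} :
    ContDiff ℝ n fun p : CoordIndex g → ℝ => invGramBlock c p z w := by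
  simp only [invGramBlock, Matrix.of_apply, imMat_apply]
  fun_prop

/-- The densitized inverse metric `√|G| G^{IJ}` of the normalized invariant metric. -/
noncomputable def densInv (c : ℝ) (I J : CoordIndex g) (p : CoordIndex g → ℝ) : ℝ :=
  ((imMat p).det ^ (g + 1))⁻¹ * fromBlocks (invGramBlock c p) 0 0 (invGramBlock c p) I J

theorem contDiffAt_densInv (c : ℝ) (I J : CoordIndex g) {p : CoordIndex g → ℝ}
    (hp : p ∈ coordDomain g) {n : WithTop ℕ∞} : ContDiffAt ℝ n (densInv c I J) p := by
  refine ContDiffAt.mul ((contDiff_det_imMat.contDiffAt.pow _).inv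
    (pow_ne_zero _ (det_imMat_pos hp).ne')) ?_
  rcases I with z | z <;> rcases J with w | w
  · exact (contDiff_invGramBlock c z w).contDiffAt
  · exact contDiffAt_const
  · exact contDiffAt_const
  · exact (contDiff_invGramBlock c z w).contDiffAt

theorem sqrt_det_gram_mul_inv {c : ℝ} (hc : IsNormalized g c) {p : CoordIndex g → ℝ}
    (hp : p ∈ coordDomain g) (I J : CoordIndex g) :
    √|(gram c p).det| * (gram c p)⁻¹ I J = densInv c I J p := by
  rw [hc.2 p hp, inv_gram hc.1.ne' hp, ofCoords_map_im, densInv]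

/-- Only derivatives in `Y` can contribute. Differentiating `det Y ^ -(g+1)` gives `-(g+1) c⁻¹ Y_kl`
times the density, and differentiating the quadratic entries gives `+(g+1) c⁻¹ Y_kl` times it, so
they cancel. -/
theorem sum_fderiv_densInv (c : ℝ) {p : CoordIndex g → ℝ} (hp : p ∈ coordDomain g)
    (J : CoordIndex g) : ∑ I, fderiv ℝ (densInv c I J) p (Pi.single I 1) = 0 := by
  have hd : ∀ I h, HasLineDerivAt ℝ (densInv c I J) (fderiv ℝ (densInv c I J) p h) p h :=
    fun I h => (((contDiffAt_densInv c I J hp (n := 1)).differentiableAt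
      one_ne_zero).hasFDerivAt).hasLineDerivAt h
  have hzero : ∀ (I : CoordIndex g) h, (∀ t : ℝ, densInv c I J (p + t • h) = densInv c I J p) →
      fderiv ℝ (densInv c I J) p h = 0 := by
    intro I h hI
    refine (hd I h).unique ?_
    simp only [HasLineDerivAt, hI]
    exact hasDerivAt_const _ _
  rw [Fintype.sum_sum_type]
  have hl : ∀ z, fderiv ℝ (densInv c (Sum.inl z) J) p (Pi.single (Sum.inl z) 1) = 0 := by
    intro z
    refine hzero _ _ fun t => ?_
    simp only [densInv, imMat_add_smul, imMat_single_inl, smul_zero, add_zero, invGramBlock]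
  simp only [hl, Finset.sum_const_zero, zero_add]
  rcases J with w | w
  · exact Finset.sum_eq_zero fun z _ => hzero _ _ fun t => by simp [densInv]
  · induction w with
    | _ k l =>
      set D := ((imMat p).det ^ (g + 1))⁻¹
      have h1 : ∀ z, fderiv ℝ (densInv c (Sum.inr z) (Sum.inr s(k, l))) p
          (Pi.single (Sum.inr z) 1) =
          -((g + 1) * D) * ((∑ i, ∑ j, symUnit z i j * (imMat p)⁻¹ i j) *
            invGramBlock c p z s(k, l)) +
          D * ((2 * c)⁻¹ * (imMat p k l * (multiplicity k z + multiplicity l z))) := by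
        intro z
        rw [(hd (Sum.inr z) (Pi.single (Sum.inr z) 1)).unique
          (hasLineDerivAt_mul (hasLineDerivAt_inv_det_pow hp _ _)
            (hasLineDerivAt_invGramBlock_diag c p z k l)), imMat_single_inr, trace_mul_comm]
        have : (symUnit z * (imMat p)⁻¹).trace = ∑ i, ∑ j, symUnit z i j * (imMat p)⁻¹ i j := by
          simp only [trace, diag_apply, Matrix.mul_apply]
          refine Finset.sum_congr rfl fun i _ => Finset.sum_congr rfl fun j _ => ?_
          conv_lhs => rw [← transpose_inv_imMat, transpose_apply]
        rw [this, fromBlocks_apply₂₂]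
        push_cast
        ring
      simp_rw [h1]
      rw [Finset.sum_add_distrib, ← Finset.mul_sum, sum_symUnit_mul_invGramBlock,
        mul_nonsing_inv _ (isUnit_det_imMat hp), Matrix.one_mul, ← Finset.mul_sum,
        ← Finset.mul_sum, ← Finset.mul_sum, Finset.sum_add_distrib, sum_multiplicity,
        sum_multiplicity, imMat_comm p l k]
      ring

theorem partialDeriv_ofReal_mul {ι : Type*} [Fintype ι] [DecidableEq ι] (I : ι) {a : (ι → ℝ) → ℝ}
    {f : (ι → ℝ) → ℂ} {p : ι → ℝ} (ha : DifferentiableAt ℝ a p) (hf : DifferentiableAt ℝ f p) :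
    partialDeriv I (fun q => ((a q : ℝ) : ℂ) * f q) p =
      ((fderiv ℝ a p (Pi.single I 1) : ℝ) : ℂ) * f p + ((a p : ℝ) : ℂ) * partialDeriv I f p := by
  have h1 : (fun q => ((a q : ℝ) : ℂ) * f q) = fun q => a q • f q := by
    ext q; rw [Complex.real_smul]
  rw [partialDeriv, h1, fderiv_fun_smul ha hf]
  simp [partialDeriv, Complex.real_smul, add_comm]

theorem contDiffAt_partialDeriv {ι : Type*} [Fintype ι] [DecidableEq ι] (I : ι)
    {f : (ι → ℝ) → ℂ} {p : ι → ℝ} {m n : WithTop ℕ∞} (hf : ContDiffAt ℝ n f p) (h : m + 1 ≤ n) :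
    ContDiffAt ℝ m (partialDeriv I f) p :=
  (hf.fderiv_right h).clm_apply contDiffAt_const

/-- The product rule leaves a divergence multiplying the first derivatives, which vanishes, and the
density cancels from the second-order part. -/
theorem laplaceBeltrami_gram {c : ℝ} (hc : IsNormalized g c) {p : CoordIndex g → ℝ}
    (hp : p ∈ coordDomain g) {f : (CoordIndex g → ℝ) → ℂ} (hf : ContDiffAt ℝ 2 f p) :
    laplaceBeltrami (gram c) f p = -∑ I, ∑ J,
      ((fromBlocks (invGramBlock c p) 0 0 (invGramBlock c p) I J : ℝ) : ℂ) *
        partialDeriv I (partialDeriv J f) p := by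
  have h1 : ∀ I J, partialDeriv I (fun q => ((√|(gram c q).det| : ℝ) : ℂ) *
      (((gram c q)⁻¹ I J : ℝ) : ℂ) * partialDeriv J f q) p =
      ((fderiv ℝ (densInv c I J) p (Pi.single I 1) : ℝ) : ℂ) * partialDeriv J f p +
        ((densInv c I J p : ℝ) : ℂ) * partialDeriv I (partialDeriv J f) p := by
    intro I J
    rw [← partialDeriv_ofReal_mul I
      ((contDiffAt_densInv c I J hp (n := 1)).differentiableAt one_ne_zero)
      ((contDiffAt_partialDeriv J hf (m := 1) le_rfl).differentiableAt one_ne_zero)]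
    refine congrArg (fun L : _ →L[ℝ] ℂ => L (Pi.single I 1)) (Filter.EventuallyEq.fderiv_eq ?_)
    filter_upwards [isOpen_coordDomain.mem_nhds hp] with q hq
    rw [← sqrt_det_gram_mul_inv hc hq, Complex.ofReal_mul]
  simp_rw [laplaceBeltrami, h1, Finset.sum_add_distrib]
  rw [Finset.sum_comm]
  simp_rw [← Finset.sum_mul, ← Complex.ofReal_sum, sum_fderiv_densInv c hp, Complex.ofReal_zero,
    zero_mul, Finset.sum_const_zero, zero_add]
  have hD : (((imMat p).det ^ (g + 1))⁻¹ : ℝ) ≠ 0 := by have := det_imMat_pos hp; positivity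
  rw [hc.2 p hp, ofCoords_map_im, Finset.mul_sum]
  congr 1
  refine Finset.sum_congr rfl fun I _ => ?_
  rw [Finset.mul_sum]
  refine Finset.sum_congr rfl fun J _ => ?_
  rw [densInv, Complex.ofReal_mul, mul_assoc, inv_mul_cancel_left₀ (Complex.ofReal_ne_zero.2 hD)]

theorem gramBlock_one (c : ℝ) {p : CoordIndex g → ℝ} (hp : imMat p = 1) :
    gramBlock c p = diagonal fun z => c * if z.IsDiag then 1 else 2 := by
  ext z w
  simp only [gramBlock, hp, inv_one, Matrix.one_mul, Matrix.mul_one, of_apply, trace, diag_apply,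
    Matrix.mul_apply]
  have h1 : ∀ i j, symUnit w j i = symUnit w i j := fun i j => by
    rw [symUnit_apply, symUnit_apply, Sym2.eq_swap]
  simp only [h1]
  rw [diagonal_apply]
  split_ifs with hzw hz
  · subst hzw
    induction z with
    | _ a b =>
      obtain rfl : a = b := hz
      simp only [symUnit_apply, Sym2.eq_iff, or_self, ite_and, mul_ite, mul_one, mul_zero]
      simp
  · subst hzw
    induction z with
    | _ a b =>
      have hab : a ≠ b := hz
      have h2 : ∀ i j, symUnit s(a, b) i j * symUnit s(a, b) i j =
          (if i = a then if j = b then (1 : ℝ) else 0 else 0) +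
            (if i = b then if j = a then (1 : ℝ) else 0 else 0) := by
        intro i j
        simp only [symUnit_apply, Sym2.eq_iff]
        by_cases h1 : i = a <;> by_cases h2 : i = b <;> by_cases h3 : j = a <;>
          by_cases h4 : j = b <;> simp_all
      simp only [h2, Finset.sum_add_distrib]
      simp; norm_num
  · rw [Finset.sum_eq_zero, mul_zero]
    refine fun i _ => Finset.sum_eq_zero fun j _ => ?_
    rw [symUnit_apply, symUnit_apply]
    split_ifs with h1 h2 <;> simp
    exact hzw (h1.symm.trans h2)

theorem inv_normalization [NeZero g] {c : ℝ} (hc : IsNormalized g c) :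
    c⁻¹ = (2 : ℝ) ^ (((g : ℝ) - 1) / ((g : ℝ) + 1)) := by
  -- At `τ = i` the Gram block is diagonal, with entry `c` on diagonal pairs and `2c` on the others,
  -- so the volume condition reads `c^(g(g+1)/2) 2^(g(g-1)/2) = 1`.
  set p : CoordIndex g → ℝ := Sum.elim (fun _ => 0) fun z => if z.IsDiag then 1 else 0
  have hp : imMat p = 1 := by
    ext i j
    simp [imMat_apply, p, one_apply]
  have hpd : p ∈ coordDomain g := by
    rw [mem_coordDomain, hp]; exact PosDef.one
  have h1 := hc.2 p hpd
  rw [ofCoords_map_im, hp, det_one, one_pow, inv_one, gram_eq_fromBlocks, det_fromBlocks_zero₂₁,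
    gramBlock_one c hp, det_diagonal, abs_mul_self, ← pow_two, Real.sqrt_sq] at h1
  swap
  · exact Finset.prod_nonneg fun z _ => by have := hc.1; positivity
  rw [Finset.prod_mul_distrib, Finset.prod_const, Finset.prod_ite, Finset.prod_const_one, one_mul,
    Finset.prod_const, Finset.card_univ, Sym2.card, Fintype.card_fin] at h1
  have h2 : (Finset.univ.filter fun z : Sym2 (Fin g) => ¬z.IsDiag).card = g.choose 2 := by
    rw [← Fintype.card_subtype, Sym2.card_subtype_not_diag, Fintype.card_fin]
  rw [h2] at h1
  have hg : (0 : ℝ) < g := Nat.cast_pos.2 (Nat.pos_of_ne_zero (NeZero.ne g))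
  have h3 := congrArg Real.log h1
  rw [Real.log_mul (pow_pos hc.1 _).ne' (by positivity), Real.log_pow, Real.log_pow, Real.log_one,
    Nat.cast_choose_two, Nat.cast_choose_two] at h3
  push_cast at h3
  have h4 : ((g : ℝ) + 1) * Real.log c + ((g : ℝ) - 1) * Real.log 2 = 0 := by
    have : (g : ℝ) / 2 * (((g : ℝ) + 1) * Real.log c + ((g : ℝ) - 1) * Real.log 2) = 0 := by
      rw [← h3]; ring
    rcases mul_eq_zero.1 this with h | h
    · linarith
    · exact h
  rw [← Real.exp_log (inv_pos.2 hc.1), Real.rpow_def_of_pos two_pos, Real.log_inv]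
  congr 1
  field_simp
  linarith

end LaplacianFormula

/-! ### Powers of the quadratic form as eigenfunctions. -/

section Eigenfunction

variable {g : ℕ}

theorem sum_fromBlocks_mul {ι : Type*} [Fintype ι] (A : Matrix ι ι ℝ) (F : ι ⊕ ι → ι ⊕ ι → ℝ) :
    ∑ I, ∑ J, fromBlocks A 0 0 A I J * F I J =
      ∑ z, ∑ w, A z w * F (Sum.inl z) (Sum.inl w) + ∑ z, ∑ w, A z w * F (Sum.inr z) (Sum.inr w) := by
  simp [Fintype.sum_sum_type]

/-- With `ω = invVec v` one has `Q = ωᵀYω + mᵀYm`. The `X` directions contribute `2c⁻¹((ωᵀYω)(mᵀYm)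
+ (ωᵀYm)²)`, the `Y` directions `c⁻¹((ωᵀYω)² - 2(ωᵀYm)² + (mᵀYm)²)`; the mixed squares cancel and a
perfect square remains. -/
theorem sum_invGramBlock_fderiv_mul (c : ℝ) (v : Fin g ⊕ Fin g → ℝ) {p : CoordIndex g → ℝ}
    (hp : p ∈ coordDomain g) :
    ∑ I, ∑ J, fromBlocks (invGramBlock c p) 0 0 (invGramBlock c p) I J *
      (fderiv ℝ (quadForm v) p (Pi.single I 1) * fderiv ℝ (quadForm v) p (Pi.single J 1)) =
      c⁻¹ * quadForm v p ^ 2 := by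
  rw [sum_fromBlocks_mul]
  simp only [fderiv_quadForm v hp, reMat_single_inl, reMat_single_inr, imMat_single_inl,
    imMat_single_inr, zero_mulVec, dotProduct_zero, sub_zero, add_zero, mul_zero, zero_sub]
  set ω := invVec v p
  set m : Fin g → ℝ := v ∘ Sum.inl
  have e1 : ∀ z w, invGramBlock c p z w * (2 * (ω ⬝ᵥ symUnit z *ᵥ m) * (2 * (ω ⬝ᵥ symUnit w *ᵥ m)))
      = 4 * (invGramBlock c p z w * ((ω ⬝ᵥ symUnit z *ᵥ m) * (ω ⬝ᵥ symUnit w *ᵥ m))) :=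
    fun z w => by ring
  have e2 : ∀ z w, invGramBlock c p z w * ((-(ω ⬝ᵥ symUnit z *ᵥ ω) + m ⬝ᵥ symUnit z *ᵥ m) *
      (-(ω ⬝ᵥ symUnit w *ᵥ ω) + m ⬝ᵥ symUnit w *ᵥ m)) =
      invGramBlock c p z w * ((ω ⬝ᵥ symUnit z *ᵥ ω) * (ω ⬝ᵥ symUnit w *ᵥ ω)) -
      invGramBlock c p z w * ((ω ⬝ᵥ symUnit z *ᵥ ω) * (m ⬝ᵥ symUnit w *ᵥ m)) -
      invGramBlock c p z w * ((m ⬝ᵥ symUnit z *ᵥ m) * (ω ⬝ᵥ symUnit w *ᵥ ω)) +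
      invGramBlock c p z w * ((m ⬝ᵥ symUnit z *ᵥ m) * (m ⬝ᵥ symUnit w *ᵥ m)) :=
    fun z w => by ring
  simp_rw [e1, e2, Finset.sum_add_distrib, Finset.sum_sub_distrib, ← Finset.mul_sum,
    sum_sum_invGramBlock]
  have hQ : quadForm v p = ω ⬝ᵥ imMat p *ᵥ ω + m ⬝ᵥ imMat p *ᵥ m := by
    rw [quadForm, imMat_mulVec_invVec v hp, dotProduct_comm]
  rw [hQ, imMat_mulVec_dotProduct p m ω, dotProduct_comm (imMat p *ᵥ m) ω, mul_inv]
  ring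

theorem dotProduct_mulVec_eq_sum (A : Matrix (Fin g) (Fin g) ℝ) (a b : Fin g → ℝ) :
    a ⬝ᵥ A *ᵥ b = ∑ i, ∑ j, A i j * (a i * b j) := by
  simp only [mulVec, dotProduct, Finset.mul_sum]
  exact Finset.sum_congr rfl fun i _ => Finset.sum_congr rfl fun j _ => by ring

/-- Expanding `Y⁻¹` in the standard basis reduces to the rank-one rule. One of its terms gives the
factor `g = tr(Y⁻¹Y)`, the other gives `(Ya)ᵀY⁻¹(Ya) = aᵀYa`. -/
theorem sum_invGramBlock_quadratic (c : ℝ) {p : CoordIndex g → ℝ} (hp : p ∈ coordDomain g)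
    (a : Fin g → ℝ) :
    ∑ z, ∑ w, invGramBlock c p z w *
      ((symUnit z *ᵥ a) ⬝ᵥ (imMat p)⁻¹ *ᵥ (symUnit w *ᵥ a)) =
      (2 * c)⁻¹ * ((g + 1) * (a ⬝ᵥ imMat p *ᵥ a)) := by
  have h1 : ∀ z w, (symUnit z *ᵥ a) ⬝ᵥ (imMat p)⁻¹ *ᵥ (symUnit w *ᵥ a) =
      ∑ i, ∑ j, (imMat p)⁻¹ i j * ((Pi.single i 1 ⬝ᵥ symUnit z *ᵥ a) *
        (Pi.single j 1 ⬝ᵥ symUnit w *ᵥ a)) := by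
    intro z w
    simp only [single_one_dotProduct]
    exact dotProduct_mulVec_eq_sum _ _ _
  have h2 : ∑ z, ∑ w, invGramBlock c p z w *
      ((symUnit z *ᵥ a) ⬝ᵥ (imMat p)⁻¹ *ᵥ (symUnit w *ᵥ a)) =
      ∑ i, ∑ j, (imMat p)⁻¹ i j * ∑ z, ∑ w, invGramBlock c p z w *
        ((Pi.single i 1 ⬝ᵥ symUnit z *ᵥ a) * (Pi.single j 1 ⬝ᵥ symUnit w *ᵥ a)) := by
    simp_rw [h1, Finset.mul_sum]
    rw [Finset.sum_congr rfl fun z _ => Finset.sum_comm, Finset.sum_comm]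
    refine Finset.sum_congr rfl fun i _ => ?_
    rw [Finset.sum_congr rfl fun z _ => Finset.sum_comm, Finset.sum_comm]
    exact Finset.sum_congr rfl fun j _ => Finset.sum_congr rfl fun z _ =>
      Finset.sum_congr rfl fun w _ => by ring
  have hu := isUnit_det_imMat hp
  have h3 : ∑ i, ∑ j, (imMat p)⁻¹ i j * imMat p i j = g := by
    have : ((imMat p)⁻¹ * imMat p).trace = g := by
      rw [nonsing_inv_mul _ hu, trace_one, Fintype.card_fin]
    rw [← this]
    simp only [trace, diag_apply, Matrix.mul_apply]
    exact Finset.sum_congr rfl fun i _ => Finset.sum_congr rfl fun j _ => by rw [imMat_comm]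
  have h4 : ∑ i, ∑ j, (imMat p)⁻¹ i j * ((imMat p *ᵥ a) i * (imMat p *ᵥ a) j) =
      a ⬝ᵥ imMat p *ᵥ a := by
    have : (imMat p *ᵥ a) ⬝ᵥ ((imMat p)⁻¹ *ᵥ (imMat p *ᵥ a)) = a ⬝ᵥ imMat p *ᵥ a := by
      rw [mulVec_mulVec, nonsing_inv_mul _ hu, one_mulVec, dotProduct_comm]
    rw [← this, dotProduct_mulVec_eq_sum]
  have h5 : ∀ i j, (Pi.single i 1 : Fin g → ℝ) ⬝ᵥ imMat p *ᵥ Pi.single j 1 = imMat p i j := by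
    intro i j; simp
  have h6 : ∀ i, a ⬝ᵥ imMat p *ᵥ Pi.single i 1 = (imMat p *ᵥ a) i := by
    intro i; rw [imMat_mulVec_dotProduct, dotProduct_single_one]
  simp_rw [h2, sum_sum_invGramBlock, h5, single_one_dotProduct, h6]
  rw [add_mul, one_mul]
  nth_rewrite 1 [← h3]
  nth_rewrite 3 [← h4]
  rw [Finset.sum_mul, ← Finset.sum_add_distrib, Finset.mul_sum]
  refine Finset.sum_congr rfl fun i _ => ?_
  rw [Finset.sum_mul, ← Finset.sum_add_distrib, Finset.mul_sum]
  exact Finset.sum_congr rfl fun j _ => by ring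

theorem sum_invGramBlock_fderiv_fderiv (c : ℝ) (v : Fin g ⊕ Fin g → ℝ) {p : CoordIndex g → ℝ}
    (hp : p ∈ coordDomain g) :
    ∑ I, ∑ J, fromBlocks (invGramBlock c p) 0 0 (invGramBlock c p) I J *
      fderiv ℝ (fun q => fderiv ℝ (quadForm v) q (Pi.single J 1)) p (Pi.single I 1) =
      c⁻¹ * ((g + 1) * quadForm v p) := by
  rw [sum_fromBlocks_mul]
  simp only [fderiv_fderiv_quadForm v hp, tangentVec, reMat_single_inl, reMat_single_inr,
    imMat_single_inl, imMat_single_inr, zero_mulVec, sub_zero, zero_sub, mulVec_neg,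
    neg_dotProduct, dotProduct_neg, neg_neg]
  have e : ∀ (a : Fin g → ℝ) z w, invGramBlock c p z w *
      (2 * ((symUnit w *ᵥ a) ⬝ᵥ (imMat p)⁻¹ *ᵥ (symUnit z *ᵥ a))) =
      2 * (invGramBlock c p z w * ((symUnit z *ᵥ a) ⬝ᵥ (imMat p)⁻¹ *ᵥ (symUnit w *ᵥ a))) := by
    intro a z w
    rw [inv_imMat_mulVec_dotProduct, dotProduct_comm]
    ring
  simp_rw [e, ← Finset.mul_sum, sum_invGramBlock_quadratic c hp]
  rw [quadForm, imMat_mulVec_invVec v hp, dotProduct_comm (affVec v p), mul_inv]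
  ring

/-- The function `quadForm v p ^ (-s)`, for a positive value of the quadratic form. -/
noncomputable def planeWave (s : ℂ) (v : Fin g ⊕ Fin g → ℝ) (p : CoordIndex g → ℝ) : ℂ :=
  Complex.exp (-s * (Real.log (quadForm v p) : ℂ))

theorem contDiffAt_planeWave (s : ℂ) {q : (Fin g ⊕ Fin g → ℝ) × (CoordIndex g → ℝ)}
    (hv : q.1 ≠ 0) (hq : q.2 ∈ coordDomain g) {n : WithTop ℕ∞} : ContDiffAt ℝ n
      (fun q : (Fin g ⊕ Fin g → ℝ) × (CoordIndex g → ℝ) => planeWave s q.1 q.2) q := by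
  unfold planeWave
  exact (contDiffAt_const.mul (Complex.ofRealCLM.contDiff.contDiffAt.comp q
    ((contDiffAt_quadForm hq).log (quadForm_pos hv hq).ne'))).cexp

theorem contDiffAt_planeWave_right (s : ℂ) {v : Fin g ⊕ Fin g → ℝ} (hv : v ≠ 0)
    {p : CoordIndex g → ℝ} (hp : p ∈ coordDomain g) {n : WithTop ℕ∞} :
    ContDiffAt ℝ n (planeWave s v) p :=
  ContDiffAt.comp (f := fun q => (v, q)) p (contDiffAt_planeWave s (q := (v, p)) hv hp)
    (by fun_prop)

theorem partialDeriv_planeWave (s : ℂ) {v : Fin g ⊕ Fin g → ℝ} (hv : v ≠ 0)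
    {p : CoordIndex g → ℝ} (hp : p ∈ coordDomain g) (J : CoordIndex g) :
    partialDeriv J (planeWave s v) p =
      (((quadForm v p)⁻¹ * fderiv ℝ (quadForm v) p (Pi.single J 1) : ℝ) : ℂ) *
        (-s * planeWave s v p) := by
  have h1 := ((contDiffAt_planeWave_right s hv hp (n := 1)).differentiableAt
    one_ne_zero).hasFDerivAt.hasLineDerivAt (Pi.single J 1)
  have h2 := ((contDiffAt_quadForm_right v hp (n := 1)).differentiableAt
    one_ne_zero).hasFDerivAt.hasLineDerivAt (Pi.single J 1)
  have h3 : HasLineDerivAt ℝ (planeWave s v) _ p (Pi.single J 1) := HasDerivAt.cexp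
    (((HasDerivAt.log h2 (by simpa using (quadForm_pos hv hp).ne')).ofReal_comp).const_mul (-s))
  rw [partialDeriv, h1.unique h3]
  simp only [zero_smul, add_zero, planeWave]
  push_cast
  ring

theorem partialDeriv_partialDeriv_planeWave (s : ℂ) {v : Fin g ⊕ Fin g → ℝ} (hv : v ≠ 0)
    {p : CoordIndex g → ℝ} (hp : p ∈ coordDomain g) (I J : CoordIndex g) :
    partialDeriv I (partialDeriv J (planeWave s v)) p =
      ((s ^ 2 + s) * ((quadForm v p)⁻¹ ^ 2 * (fderiv ℝ (quadForm v) p (Pi.single I 1) *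
        fderiv ℝ (quadForm v) p (Pi.single J 1)) : ℝ) - s * ((quadForm v p)⁻¹ *
        fderiv ℝ (fun q => fderiv ℝ (quadForm v) q (Pi.single J 1)) p (Pi.single I 1) : ℝ)) *
        planeWave s v p := by
  have hQ := (quadForm_pos hv hp).ne'
  have h1 : partialDeriv I (partialDeriv J (planeWave s v)) p = partialDeriv I (fun q =>
      (((quadForm v q)⁻¹ * fderiv ℝ (quadForm v) q (Pi.single J 1) : ℝ) : ℂ) *
        (-s * planeWave s v q)) p := by
    refine congrArg (fun L : _ →L[ℝ] ℂ => L (Pi.single I 1)) (Filter.EventuallyEq.fderiv_eq ?_)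
    filter_upwards [isOpen_coordDomain.mem_nhds hp] with q hq
    exact partialDeriv_planeWave s hv hq J
  have hd1 : DifferentiableAt ℝ (quadForm v) p :=
    (contDiffAt_quadForm_right v hp (n := 1)).differentiableAt one_ne_zero
  have hd2 : DifferentiableAt ℝ (fun q => fderiv ℝ (quadForm v) q (Pi.single J 1)) p :=
    (((contDiffAt_quadForm_right v hp (n := 2)).fderiv_right (m := 1) le_rfl).clm_apply
      contDiffAt_const).differentiableAt one_ne_zero
  have hd3 : DifferentiableAt ℝ (planeWave s v) p :=
    (contDiffAt_planeWave_right s hv hp (n := 1)).differentiableAt one_ne_zero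
  have h2 : partialDeriv I (fun q => -s * planeWave s v q) p =
      -s * partialDeriv I (planeWave s v) p := by
    rw [partialDeriv, fderiv_const_mul hd3]
    simp [partialDeriv]
  rw [h1, partialDeriv_ofReal_mul I (hd1.fun_inv hQ |>.fun_mul hd2) (hd3.const_mul _), h2,
    partialDeriv_planeWave s hv hp I, fderiv_fun_mul (hd1.fun_inv hQ) hd2]
  have h3 : fderiv ℝ (fun q => (quadForm v q)⁻¹) p = _ :=
    ((hasDerivAt_inv hQ).comp_hasFDerivAt p hd1.hasFDerivAt).fderiv
  simp only [h3]
  simp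
  ring

/-- The chain rule combines the two contractions into `c⁻¹((s² + s) - s(g + 1)) = -c⁻¹ s(g - s)`. -/
theorem sum_invGramBlock_planeWave (c : ℝ) (s : ℂ) {v : Fin g ⊕ Fin g → ℝ} (hv : v ≠ 0)
    {p : CoordIndex g → ℝ} (hp : p ∈ coordDomain g) :
    ∑ I, ∑ J, ((fromBlocks (invGramBlock c p) 0 0 (invGramBlock c p) I J : ℝ) : ℂ) *
      partialDeriv I (partialDeriv J (planeWave s v)) p =
      -((c⁻¹ : ℝ) * s * (g - s) * planeWave s v p) := by
  have hQ := (quadForm_pos hv hp).ne'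
  set A := fromBlocks (invGramBlock c p) 0 0 (invGramBlock c p) with hA
  have h1 : ∀ I J, ((A I J : ℝ) : ℂ) * partialDeriv I (partialDeriv J (planeWave s v)) p =
      (s ^ 2 + s) * ((quadForm v p)⁻¹ ^ 2 : ℝ) * planeWave s v p *
        ((A I J * (fderiv ℝ (quadForm v) p (Pi.single I 1) *
          fderiv ℝ (quadForm v) p (Pi.single J 1)) : ℝ) : ℂ) -
      s * ((quadForm v p)⁻¹ : ℝ) * planeWave s v p * ((A I J *
        fderiv ℝ (fun q => fderiv ℝ (quadForm v) q (Pi.single J 1)) p (Pi.single I 1) : ℝ) : ℂ) := by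
    intro I J
    rw [partialDeriv_partialDeriv_planeWave s hv hp]
    push_cast
    ring
  simp_rw [h1, Finset.sum_sub_distrib, ← Finset.mul_sum, ← Complex.ofReal_sum, hA,
    sum_invGramBlock_fderiv_mul c v hp, sum_invGramBlock_fderiv_fderiv c v hp]
  have hQ' : (quadForm v p : ℂ) ≠ 0 := Complex.ofReal_ne_zero.2 hQ
  push_cast
  field_simp
  ring

end Eigenfunction

/-! ### Termwise differentiation of weighted sums over a compact parameter set. -/

section CompactFamilies

open scoped ContDiff

variable {ι V E F : Type*}

theorem summable_smul_of_isCompact [TopologicalSpace V] [TopologicalSpace E]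
    [NormedAddCommGroup F] [NormedSpace ℂ F] [CompleteSpace F] {Φ : V × E → F} {S K : Set V} {Ω : Set E}
    (hΦ : ContinuousOn Φ (S ×ˢ Ω)) (hK : IsCompact K) (hKS : K ⊆ S) {θ : ι → V}
    (hθ : ∀ i, θ i ∈ K) {w : ι → ℂ} (hw : Summable fun i => ‖w i‖) {p : E} (hp : p ∈ Ω) :
    Summable fun i => w i • Φ (θ i, p) := by
  have hc : ContinuousOn (fun v => Φ (v, p)) K :=
    hΦ.comp (by fun_prop) fun v hv => ⟨hKS hv, hp⟩
  obtain ⟨C, hC⟩ := hK.exists_bound_of_continuousOn hc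
  refine Summable.of_norm_bounded (hw.mul_right C) fun i => ?_
  rw [norm_smul]
  exact mul_le_mul_of_nonneg_left (hC _ (hθ i)) (norm_nonneg _)

variable [NormedAddCommGroup V] [NormedSpace ℝ V]
  [NormedAddCommGroup E] [NormedSpace ℝ E] [NormedAddCommGroup F] [NormedSpace ℝ F]

/-- The derivative of a function of two variables in the second variable. -/
noncomputable def fderivRight (Φ : V × E → F) (x : V × E) : E →L[ℝ] F :=
  (fderiv ℝ Φ x).comp (ContinuousLinearMap.inr ℝ V E)

theorem hasFDerivAt_fderivRight {Φ : V × E → F} {v : V} {p : E}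
    (h : DifferentiableAt ℝ Φ (v, p)) :
    HasFDerivAt (fun q => Φ (v, q)) (fderivRight Φ (v, p)) p :=
  h.hasFDerivAt.comp p (hasFDerivAt_prodMk_right v p)

theorem contDiffOn_fderivRight {Φ : V × E → F} {D : Set (V × E)} (hD : IsOpen D)
    {m n : WithTop ℕ∞} (hmn : m + 1 ≤ n) (h : ContDiffOn ℝ n Φ D) :
    ContDiffOn ℝ m (fderivRight Φ) D :=
  (h.fderiv_of_isOpen hD hmn).clm_comp contDiffOn_const

theorem contDiffOn_infty_fderivRight {Φ : V × E → F} {D : Set (V × E)} (hD : IsOpen D)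
    (h : ContDiffOn ℝ ∞ Φ D) : ContDiffOn ℝ ∞ (fderivRight Φ) D :=
  contDiffOn_fderivRight hD (by simp) h

variable [NormedSpace ℂ F] [SMulCommClass ℝ ℂ F] [ProperSpace E]

/-- On the compact product of `K` with a small closed ball the derivative of `Φ` is bounded by one
constant, so the weights dominate the differentiated series. -/
theorem hasFDerivAt_tsum_smul [CompleteSpace F] {Φ : V × E → F} {S K : Set V} {Ω : Set E}
    (hS : IsOpen S) (hΩ : IsOpen Ω) (hΦ : ContDiffOn ℝ ∞ Φ (S ×ˢ Ω)) (hK : IsCompact K)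
    (hKS : K ⊆ S) {θ : ι → V} (hθ : ∀ i, θ i ∈ K) {w : ι → ℂ} (hw : Summable fun i => ‖w i‖)
    {p : E} (hp : p ∈ Ω) :
    HasFDerivAt (fun q => ∑' i, w i • Φ (θ i, q)) (∑' i, w i • fderivRight Φ (θ i, p)) p := by
  obtain ⟨r, hr, hball⟩ := Metric.nhds_basis_closedBall.mem_iff.1 (hΩ.mem_nhds hp)
  have hcomp : IsCompact (K ×ˢ Metric.closedBall p r) := hK.prod (isCompact_closedBall p r)
  obtain ⟨C, hC⟩ := hcomp.exists_bound_of_continuousOn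
    ((contDiffOn_infty_fderivRight (hS.prod hΩ) hΦ).continuousOn.mono (Set.prod_mono hKS hball))
  have hmem : ∀ i, ∀ q ∈ Metric.ball p r, (θ i, q) ∈ S ×ˢ Ω := fun i q hq =>
    ⟨hKS (hθ i), hball (Metric.ball_subset_closedBall hq)⟩
  have h1 : ∀ i, ∀ q ∈ Metric.ball p r,
      HasFDerivAt (fun q => w i • Φ (θ i, q)) (w i • fderivRight Φ (θ i, q)) q := by
    intro i q hq
    have hd := (hΦ.contDiffAt ((hS.prod hΩ).mem_nhds (hmem i q hq))).differentiableAt (by simp)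
    exact (hasFDerivAt_fderivRight hd).fun_const_smul (w i)
  have h2 : ∀ i, ∀ q ∈ Metric.ball p r, ‖w i • fderivRight Φ (θ i, q)‖ ≤ ‖w i‖ * C := by
    intro i q hq
    rw [norm_smul]
    exact mul_le_mul_of_nonneg_left (hC _ ⟨hθ i, Metric.ball_subset_closedBall hq⟩)
      (norm_nonneg _)
  exact hasFDerivAt_tsum_of_isPreconnected (hw.mul_right C)
    Metric.isOpen_ball (convex_ball p r).isPreconnected h1 h2
    (Metric.mem_ball_self hr)
    (summable_smul_of_isCompact hΦ.continuousOn hK hKS hθ hw hp) (Metric.mem_ball_self hr)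

end CompactFamilies

section CompactFamiliesSmooth

open scoped ContDiff

universe u

variable {ι V : Type*} {E : Type u} [NormedAddCommGroup V] [NormedSpace ℝ V]
  [NormedAddCommGroup E] [NormedSpace ℝ E] [ProperSpace E]

/-- The derivative is a sum of the same shape with values in `E →L[ℝ] F`, so the induction must vary
`F`; `E` and `F` share a universe to make this possible. -/
theorem contDiffOn_tsum_smul (n : ℕ) {F : Type u} [NormedAddCommGroup F] [NormedSpace ℝ F]
    [NormedSpace ℂ F] [SMulCommClass ℝ ℂ F] [CompleteSpace F] {Φ : V × E → F} {S K : Set V}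
    {Ω : Set E} (hS : IsOpen S) (hΩ : IsOpen Ω) (hΦ : ContDiffOn ℝ ∞ Φ (S ×ˢ Ω))
    (hK : IsCompact K) (hKS : K ⊆ S) {θ : ι → V} (hθ : ∀ i, θ i ∈ K) {w : ι → ℂ}
    (hw : Summable fun i => ‖w i‖) : ContDiffOn ℝ n (fun q => ∑' i, w i • Φ (θ i, q)) Ω := by
  induction n generalizing F with
  | zero =>
    rw [Nat.cast_zero, contDiffOn_zero]
    exact fun p hp =>
      (hasFDerivAt_tsum_smul hS hΩ hΦ hK hKS hθ hw hp).continuousAt.continuousWithinAt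
  | succ n ih =>
    push_cast
    rw [contDiffOn_succ_iff_fderiv_of_isOpen hΩ]
    refine ⟨fun p hp => (hasFDerivAt_tsum_smul hS hΩ hΦ hK hKS hθ hw
      hp).differentiableAt.differentiableWithinAt, by simp, ?_⟩
    exact (ih (contDiffOn_infty_fderivRight (hS.prod hΩ) hΦ)).congr fun p hp =>
      (hasFDerivAt_tsum_smul hS hΩ hΦ hK hKS hθ hw hp).fderiv

end CompactFamiliesSmooth

section CompactFamiliesPartial

open scoped ContDiff

variable {ι V κ : Type*} [NormedAddCommGroup V] [NormedSpace ℝ V] [Fintype κ] [DecidableEq κ]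

theorem partialDeriv_right (J : κ) {Φ : V × (κ → ℝ) → ℂ} {v : V} {p : κ → ℝ}
    (h : DifferentiableAt ℝ Φ (v, p)) :
    partialDeriv J (fun q => Φ (v, q)) p = fderivRight Φ (v, p) (Pi.single J 1) := by
  rw [partialDeriv, (hasFDerivAt_fderivRight h).fderiv]

theorem contDiffOn_partialDeriv_right (J : κ) {Φ : V × (κ → ℝ) → ℂ} {S : Set V} {Ω : Set (κ → ℝ)}
    (hS : IsOpen S) (hΩ : IsOpen Ω) {m n : WithTop ℕ∞} (hmn : m + 1 ≤ n)
    (hΦ : ContDiffOn ℝ n Φ (S ×ˢ Ω)) :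
    ContDiffOn ℝ m (fun x : V × (κ → ℝ) => partialDeriv J (fun q => Φ (x.1, q)) x.2) (S ×ˢ Ω) := by
  refine ((contDiffOn_fderivRight (hS.prod hΩ) hmn hΦ).clm_apply
    (contDiffOn_const (c := Pi.single J 1))).congr fun x hx => ?_
  exact partialDeriv_right J ((hΦ.contDiffAt ((hS.prod hΩ).mem_nhds hx)).differentiableAt
    (ne_of_gt (lt_of_lt_of_le one_pos (le_add_self.trans hmn))))

theorem partialDeriv_tsum_smul (J : κ) {Φ : V × (κ → ℝ) → ℂ} {S K : Set V} {Ω : Set (κ → ℝ)}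
    (hS : IsOpen S) (hΩ : IsOpen Ω) (hΦ : ContDiffOn ℝ ∞ Φ (S ×ˢ Ω)) (hK : IsCompact K)
    (hKS : K ⊆ S) {θ : ι → V} (hθ : ∀ i, θ i ∈ K) {w : ι → ℂ} (hw : Summable fun i => ‖w i‖)
    {p : κ → ℝ} (hp : p ∈ Ω) :
    partialDeriv J (fun q => ∑' i, w i • Φ (θ i, q)) p =
      ∑' i, w i • partialDeriv J (fun q => Φ (θ i, q)) p := by
  have h1 : Summable fun i => w i • fderivRight Φ (θ i, p) :=
    summable_smul_of_isCompact (contDiffOn_infty_fderivRight (hS.prod hΩ) hΦ).continuousOn hK hKS hθ hw hp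
  rw [partialDeriv, (hasFDerivAt_tsum_smul hS hΩ hΦ hK hKS hθ hw hp).fderiv]
  rw [← ContinuousLinearMap.apply_apply (𝕜 := ℝ) (Pi.single J 1 : κ → ℝ),
    ContinuousLinearMap.map_tsum _ h1]
  refine tsum_congr fun i => ?_
  have hd := (hΦ.contDiffAt ((hS.prod hΩ).mem_nhds
    (Set.mk_mem_prod (hKS (hθ i)) hp))).differentiableAt (by simp)
  rw [partialDeriv_right J hd]
  rfl

theorem partialDeriv_congr_of_isOpen (J : κ) {f f₁ : (κ → ℝ) → ℂ} {Ω : Set (κ → ℝ)}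
    (hΩ : IsOpen Ω) (h : Set.EqOn f f₁ Ω) {p : κ → ℝ} (hp : p ∈ Ω) :
    partialDeriv J f p = partialDeriv J f₁ p :=
  congrArg (fun L : _ →L[ℝ] ℂ => L (Pi.single J 1))
    (h.eventuallyEq_of_mem (hΩ.mem_nhds hp)).fderiv_eq

theorem sum_partialDeriv_tsum_smul (A : κ → κ → ℂ) {Φ : V × (κ → ℝ) → ℂ} {S K : Set V}
    {Ω : Set (κ → ℝ)} (hS : IsOpen S) (hΩ : IsOpen Ω) (hΦ : ContDiffOn ℝ ∞ Φ (S ×ˢ Ω))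
    (hK : IsCompact K) (hKS : K ⊆ S) {θ : ι → V} (hθ : ∀ i, θ i ∈ K) {w : ι → ℂ}
    (hw : Summable fun i => ‖w i‖) {p : κ → ℝ} (hp : p ∈ Ω) :
    ∑ I, ∑ J, A I J * partialDeriv I (partialDeriv J fun q => ∑' i, w i • Φ (θ i, q)) p =
      ∑' i, w i • ∑ I, ∑ J, A I J * partialDeriv I (partialDeriv J fun q => Φ (θ i, q)) p := by
  have h1 := fun J => contDiffOn_partialDeriv_right J hS hΩ (m := ∞) (by simp) hΦ
  have h2 := fun I J => contDiffOn_partialDeriv_right I hS hΩ (m := ∞) (by simp) (h1 J)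
  have h3 : ∀ I J, partialDeriv I (partialDeriv J fun q => ∑' i, w i • Φ (θ i, q)) p =
      ∑' i, w i • partialDeriv I (partialDeriv J fun q => Φ (θ i, q)) p := by
    intro I J
    rw [partialDeriv_congr_of_isOpen I hΩ
      (fun q hq => partialDeriv_tsum_smul J hS hΩ hΦ hK hKS hθ hw hq) hp]
    exact partialDeriv_tsum_smul I hS hΩ (h1 J) hK hKS hθ hw hp
  have h4 : ∀ I J, Summable fun i => w i • partialDeriv I (partialDeriv J fun q => Φ (θ i, q)) p :=
    fun I J => summable_smul_of_isCompact (h2 I J).continuousOn hK hKS hθ hw hp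
  simp_rw [h3, ← tsum_mul_left]
  simp_rw [fun I => (Summable.tsum_finsetSum (s := Finset.univ)
    (fun J _ => (h4 I J).mul_left (A I J))).symm]
  rw [← Summable.tsum_finsetSum fun I _ => summable_sum fun J _ => (h4 I J).mul_left (A I J)]
  refine tsum_congr fun i => ?_
  simp only [smul_eq_mul, Finset.mul_sum]
  exact Finset.sum_congr rfl fun I _ => Finset.sum_congr rfl fun J _ => by ring

end CompactFamiliesPartial

/-! ### The height of a transformed point as an inverse quadratic form. -/

section Height

variable {g : ℕ}

/-- Cramer's rule: the deleted minor is the `(0, 0)` entry of the adjugate. The singular case is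
covered by the convention `0⁻¹ = 0`. -/
theorem height_eq_inv [NeZero g] (τ : Matrix (Fin g) (Fin g) ℂ) :
    height τ = ((τ.map Complex.im)⁻¹ 0 0)⁻¹ := by
  set Y := τ.map Complex.im
  have h : Y.adjugate 0 0 =
      (Y.submatrix (fun i : {i : Fin g // i ≠ 0} => i.1) (fun i => i.1)).det := by
    rw [adjugate_apply, twoBlockTriangular_det' _ fun i => i = 0]
    · refine (congrArg₂ (· * ·) (?_ : _ = (1 : ℝ)) ?_).trans (one_mul _)
      · have : (toSquareBlockProp (Y.updateRow 0 (Pi.single 0 1)) fun i => i = 0) = 1 := by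
          ext ⟨i, hi⟩ ⟨j, hj⟩
          subst hi; subst hj
          simp [toSquareBlockProp, updateRow_apply]
        rw [this]
        convert! (det_one : (1 : Matrix {i : Fin g // i = 0} {i : Fin g // i = 0} ℝ).det = 1)
      · congr 1
        ext ⟨i, hi⟩ ⟨j, hj⟩
        simp [toSquareBlockProp, updateRow_apply, hi]
    · rintro i rfl j hj
      simp [hj]
  rw [height, inv_def, Ring.inverse_eq_inv', Matrix.smul_apply, smul_eq_mul, h, mul_inv, inv_inv,
    div_eq_mul_inv]

/-- Invariance of the symplectic form on the frames `(τ, 1)` and `(σ, 1)`. Taking `σ = τ` gives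
symmetry of the image, and `σ = τᴴ` gives its imaginary part. -/
theorem symplectic_pairing {R : Type*} [CommRing R] {a b c d : Matrix (Fin g) (Fin g) R}
    (h : fromBlocks a b c d ∈ symplecticGroup (Fin g) R) (σ τ : Matrix (Fin g) (Fin g) R) :
    (σ * cᵀ + dᵀ) * (a * τ + b) - (σ * aᵀ + bᵀ) * (c * τ + d) = τ - σ := by
  obtain ⟨h1, h2, h3⟩ := SymplecticGroup.fromBlocks_mem_iff.1 h
  have h4 : dᵀ * a = 1 + bᵀ * c := by
    have := congrArg transpose h3
    rw [transpose_sub, transpose_mul, transpose_mul, transpose_transpose, transpose_transpose,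
      transpose_one] at this
    rw [← this]; abel
  have e1 : (σ * cᵀ + dᵀ) * (a * τ + b) =
      σ * (cᵀ * a) * τ + σ * (cᵀ * b) + dᵀ * a * τ + dᵀ * b := by noncomm_ring
  have e2 : (σ * aᵀ + bᵀ) * (c * τ + d) =
      σ * (aᵀ * c) * τ + σ * (aᵀ * d) + bᵀ * c * τ + bᵀ * d := by noncomm_ring
  have h5 : aᵀ * d = 1 + cᵀ * b := by rw [← h3]; abel
  rw [e1, e2, h1, h2, h4, h5]
  noncomm_ring

theorem conjTranspose_map_ofReal {m n : Type*} (A : Matrix m n ℝ) :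
    (A.map Complex.ofReal)ᴴ = (A.map Complex.ofReal)ᵀ := by
  ext i j; simp

theorem eq_zero_of_star_dotProduct_mulVec {Y : Matrix (Fin g) (Fin g) ℝ} (hY : Y.PosDef)
    {v : Fin g → ℂ} (h : star v ⬝ᵥ Y.map Complex.ofReal *ᵥ v = 0) : v = 0 := by
  set x : Fin g → ℝ := fun i => (v i).re
  set y : Fin g → ℝ := fun i => (v i).im
  have h1 : x ⬝ᵥ Y *ᵥ x + y ⬝ᵥ Y *ᵥ y = 0 := by
    rw [← Complex.zero_re, ← h]
    simp only [dotProduct, mulVec, Complex.re_sum, Finset.mul_sum, ← Finset.sum_add_distrib]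
    refine Finset.sum_congr rfl fun i _ => Finset.sum_congr rfl fun j _ => ?_
    simp [x, y]
  have hx : 0 ≤ x ⬝ᵥ Y *ᵥ x := by simpa using hY.posSemidef.dotProduct_mulVec_nonneg x
  have hy : 0 ≤ y ⬝ᵥ Y *ᵥ y := by simpa using hY.posSemidef.dotProduct_mulVec_nonneg y
  have hx0 : x = 0 := by
    by_contra hne
    have := hY.dotProduct_mulVec_pos hne
    rw [star_trivial] at this
    linarith
  have hy0 : y = 0 := by
    by_contra hne
    have := hY.dotProduct_mulVec_pos hne
    rw [star_trivial] at this
    linarith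
  ext i
  exact Complex.ext (congrFun hx0 i) (congrFun hy0 i)

theorem height_moebius [NeZero g] {M : Matrix (Fin g ⊕ Fin g) (Fin g ⊕ Fin g) ℝ}
    (hM : M ∈ symplecticGroup (Fin g) ℝ) {p : CoordIndex g → ℝ} (hp : p ∈ coordDomain g) :
    height (moebius M (ofCoords p)) = (quadForm (M (Sum.inr 0)) p)⁻¹ := by
  set τ := ofCoords p with hτ
  have hMc' : fromBlocks (M.toBlocks₁₁.map Complex.ofReal) (M.toBlocks₁₂.map Complex.ofReal)
      (M.toBlocks₂₁.map Complex.ofReal) (M.toBlocks₂₂.map Complex.ofReal) ∈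
      symplecticGroup (Fin g) ℂ := by
    rw [← fromBlocks_map, fromBlocks_toBlocks]
    exact SymplecticGroup.map_mem hM Complex.ofRealHom
  have hpair := symplectic_pairing hMc'
  rw [moebius]
  set a := M.toBlocks₁₁.map Complex.ofReal with ha
  set b := M.toBlocks₁₂.map Complex.ofReal with hb
  set c := M.toBlocks₂₁.map Complex.ofReal with hc
  set d := M.toBlocks₂₂.map Complex.ofReal with hd
  set A := a * τ + b with hA
  set N := c * τ + d with hN
  set Y := (imMat p).map Complex.ofReal with hY
  have hτY : τ - τᴴ = (2 * Complex.I) • Y := by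
    ext i j
    simp only [hτ, hY, ofCoords, Matrix.sub_apply, Matrix.of_apply, conjTranspose_apply,
      Matrix.smul_apply, map_apply, imMat_apply, Sym2.eq_swap (a := j)]
    simp
    ring
  have hH : Nᴴ * A - Aᴴ * N = (2 * Complex.I) • Y := by
    rw [← hτY, ← hpair τᴴ τ, hA, hN]
    simp only [conjTranspose_add, conjTranspose_mul, ha, hb, hc, hd, conjTranspose_map_ofReal]
  have hT : Nᵀ * A - Aᵀ * N = 0 := by
    rw [← sub_self τ, ← hpair τ τ, hA, hN]
    simp only [transpose_add, transpose_mul, hτ, transpose_ofCoords]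
  -- A kernel vector `v` of `cτ + d` makes the Hermitian pairing `hH` vanish on `v`, hence `v* Y v =
  -- 0`.
  have hdet : N.det ≠ 0 := by
    intro h0
    obtain ⟨v, hv, hNv⟩ := exists_mulVec_eq_zero_iff.2 h0
    refine hv (eq_zero_of_star_dotProduct_mulVec (mem_coordDomain.1 hp) ?_)
    have h1 : star v ⬝ᵥ ((2 * Complex.I) • Y) *ᵥ v = 0 := by
      rw [← hH, sub_mulVec, ← mulVec_mulVec, ← mulVec_mulVec, hNv, mulVec_zero, sub_zero,
        dotProduct_mulVec, ← star_mulVec, hNv, star_zero, zero_dotProduct]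
    rw [smul_mulVec, dotProduct_smul, smul_eq_mul] at h1
    exact (mul_eq_zero.1 h1).resolve_left (by simp)
  have hN1 : N * N⁻¹ = 1 := mul_nonsing_inv _ hdet.isUnit
  have hN2 : N⁻¹ * N = 1 := nonsing_inv_mul _ hdet.isUnit
  have hN3 : (N⁻¹)ᴴ * Nᴴ = 1 := by rw [← conjTranspose_mul, hN1, conjTranspose_one]
  have hN4 : (N⁻¹)ᵀ * Nᵀ = 1 := by rw [← transpose_mul, hN1, transpose_one]
  set τ' := A * N⁻¹ with hτ'
  have hsymm : τ'ᵀ = τ' := by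
    have h1 : (N⁻¹)ᵀ * (Nᵀ * A - Aᵀ * N) * N⁻¹ = A * N⁻¹ - (N⁻¹)ᵀ * Aᵀ := by
      rw [Matrix.mul_sub, ← Matrix.mul_assoc, hN4, Matrix.one_mul, Matrix.sub_mul,
        Matrix.mul_assoc _ _ N⁻¹, Matrix.mul_assoc _ N, hN1, Matrix.mul_one]
    rw [hT, Matrix.mul_zero, Matrix.zero_mul] at h1
    rw [hτ', transpose_mul]
    exact (sub_eq_zero.1 h1.symm).symm
  set Y' := τ'.map Complex.im with hY'
  have hτY' : τ' - τ'ᴴ = (2 * Complex.I) • Y'.map Complex.ofReal := by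
    ext i j
    have h1 : τ' j i = τ' i j := congrFun (congrFun hsymm i) j
    simp only [Matrix.sub_apply, conjTranspose_apply, Matrix.smul_apply, map_apply, hY', h1]
    rw [Complex.star_def, Complex.sub_conj]
    simp
    ring
  have hYY : Y'.map Complex.ofReal = (N⁻¹)ᴴ * Y * N⁻¹ := by
    have h1 : (N⁻¹)ᴴ * (Nᴴ * A - Aᴴ * N) * N⁻¹ = A * N⁻¹ - (N⁻¹)ᴴ * Aᴴ := by
      rw [Matrix.mul_sub, ← Matrix.mul_assoc, hN3, Matrix.one_mul, Matrix.sub_mul,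
        Matrix.mul_assoc _ _ N⁻¹, Matrix.mul_assoc _ N, hN1, Matrix.mul_one]
    rw [hH, ← conjTranspose_mul, ← hτ', hτY', Matrix.mul_smul, Matrix.smul_mul] at h1
    exact (smul_right_injective _ (by simp : (2 * Complex.I) ≠ 0) h1).symm
  set W := ((imMat p)⁻¹).map Complex.ofReal with hW
  have hYW : Y * W = 1 := by
    have h1 : (imMat p * (imMat p)⁻¹).map Complex.ofRealHom = Y * W := Matrix.map_mul
    rw [← h1, mul_nonsing_inv _ (isUnit_det_imMat hp), Matrix.map_one _ (map_zero _) (map_one _)]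
  have hprod : Y'.map Complex.ofReal * (N * W * Nᴴ) = 1 := by
    rw [hYY, Matrix.mul_assoc, ← Matrix.mul_assoc N⁻¹, ← Matrix.mul_assoc N⁻¹, hN2,
      Matrix.one_mul, Matrix.mul_assoc, ← Matrix.mul_assoc Y, hYW, Matrix.one_mul, hN3]
  -- As `Y'` is real, taking real parts already exhibits its inverse; reality of `N W Nᴴ` need not
  -- be shown.
  have hreal : Y' * (N * W * Nᴴ).map Complex.re = 1 := by
    ext i j
    have := congrArg Complex.re (congrFun (congrFun hprod i) j)
    rw [Matrix.mul_apply, Complex.re_sum] at this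
    rw [Matrix.mul_apply]
    simp only [map_apply, Complex.re_ofReal_mul] at this ⊢
    rw [this, one_apply, one_apply]
    split_ifs <;> simp
  rw [height_eq_inv, ← hY', inv_eq_right_inv hreal]
  congr 1
  have hre : ∀ i, (N 0 i).re = affVec (M (Sum.inr 0)) p i := by
    intro i
    simp only [hN, hc, hd, hτ, Matrix.add_apply, Matrix.mul_apply, map_apply, ofCoords, of_apply,
      affVec, mulVec, dotProduct, Pi.add_apply, Function.comp, reMat_apply]
    simp [toBlocks₂₁, toBlocks₂₂, mul_comm, Sym2.eq_swap (a := i)]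
  have him : ∀ i, (N 0 i).im = (imMat p *ᵥ (M (Sum.inr 0) ∘ Sum.inl)) i := by
    intro i
    simp only [hN, hc, hd, hτ, Matrix.add_apply, Matrix.mul_apply, map_apply, ofCoords, of_apply,
      mulVec, dotProduct, Function.comp, imMat_apply]
    simp [toBlocks₂₁, toBlocks₂₂, mul_comm, Sym2.eq_swap (a := i)]
  -- Writing `mᵀYm = (Ym)ᵀY⁻¹(Ym)` matches the two summands with the real and imaginary parts `Xm +
  -- n` and `Ym` of the first row of `N`.
  have hquad : quadForm (M (Sum.inr 0)) p =
      affVec (M (Sum.inr 0)) p ⬝ᵥ (imMat p)⁻¹ *ᵥ affVec (M (Sum.inr 0)) p +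
      (imMat p *ᵥ (M (Sum.inr 0) ∘ Sum.inl)) ⬝ᵥ
        (imMat p)⁻¹ *ᵥ (imMat p *ᵥ (M (Sum.inr 0) ∘ Sum.inl)) := by
    rw [mulVec_mulVec, nonsing_inv_mul _ (isUnit_det_imMat hp), one_mulVec,
      dotProduct_comm (imMat p *ᵥ _)]
    rfl
  rw [hquad, dotProduct_mulVec_eq_sum, dotProduct_mulVec_eq_sum]
  simp only [← hre, ← him, map_apply, Matrix.mul_apply, conjTranspose_apply, Finset.sum_mul,
    Complex.re_sum, ← Finset.sum_add_distrib, hW]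
  rw [Finset.sum_comm]
  refine Finset.sum_congr rfl fun i _ => Finset.sum_congr rfl fun j _ => ?_
  simp
  ring

theorem single_vecMul_J (R : Type*) [CommRing R] (i : Fin g) :
    (Pi.single (Sum.inl i) 1 : Fin g ⊕ Fin g → R) ᵥ* J (Fin g) R = -Pi.single (Sum.inr i) 1 := by
  ext (j | j) <;> simp [J, Matrix.one_apply, Pi.single_apply, eq_comm]

theorem J_mulVec_single (R : Type*) [CommRing R] (i : Fin g) :
    J (Fin g) R *ᵥ (Pi.single (Sum.inr i) 1 : Fin g ⊕ Fin g → R) = -Pi.single (Sum.inl i) 1 := by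
  ext (j | j) <;> simp [J, Matrix.one_apply, Pi.single_apply, eq_comm]

end Height

/-! ### Cosets of the parabolic subgroup and bottom rows. -/

section Cosets

variable {g : ℕ} [NeZero g]

/-- The first row of the lower half of a modular matrix. -/
def bottomRow (γ : modularGroup g) : Fin g ⊕ Fin g → ℤ := γ.1 (Sum.inr 0)

theorem height_act (γ : modularGroup g) {p : CoordIndex g → ℝ} (hp : p ∈ coordDomain g) :
    height (act γ (ofCoords p)) = (quadForm (fun j => (bottomRow γ j : ℝ)) p)⁻¹ :=
  height_moebius (SymplecticGroup.map_mem γ.2 (Int.castRingHom ℝ)) hp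

theorem bottomRow_mul (π γ : modularGroup g) : bottomRow (π * γ) = bottomRow π ᵥ* γ.1 := by
  ext j
  simp [bottomRow, Submonoid.coe_mul, Matrix.mul_apply, vecMul, dotProduct]

theorem bottomRow_ne_zero (γ : modularGroup g) : bottomRow γ ≠ 0 := by
  intro h
  have h1 : bottomRow (γ * γ⁻¹) = 0 := by rw [bottomRow_mul, h, zero_vecMul]
  rw [mul_inv_cancel] at h1
  have := congrFun h1 (Sum.inr 0)
  simp [bottomRow] at this

/-- The relation `πᵀJπ = J` turns the eigenvector equation for a column into one for the dual row;
integrality forces the eigenvalue to be `±1`. -/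
theorem exists_bottomRow_of_mem_parabolic {π : modularGroup g} (hπ : π ∈ parabolic g ℤ) :
    ∃ t : ℤ, t ^ 2 = 1 ∧ bottomRow π = t • Pi.single (Sum.inr 0) 1 := by
  obtain ⟨t, ht⟩ := hπ
  have h1 : t • bottomRow π = Pi.single (Sum.inr 0) 1 := by
    have h2 : (π.1 *ᵥ Pi.single (Sum.inl 0) 1) ᵥ* (J (Fin g) ℤ * π.1) =
        Pi.single (Sum.inl 0) 1 ᵥ* J (Fin g) ℤ := by
      rw [← vecMul_transpose, vecMul_vecMul, ← Matrix.mul_assoc, SymplecticGroup.mem_iff'.1 π.2]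
    rw [ht, smul_vecMul, ← vecMul_vecMul, single_vecMul_J, neg_vecMul, smul_neg, neg_inj,
      single_one_vecMul] at h2
    exact h2
  have h3 : t * bottomRow π (Sum.inr 0) = 1 := by simpa using congrFun h1 (Sum.inr 0)
  have h4 : t ^ 2 = 1 := by
    rcases Int.isUnit_iff.1 (IsUnit.of_mul_eq_one _ h3) with rfl | rfl <;> norm_num
  refine ⟨t, h4, ?_⟩
  rw [← h1, smul_smul, ← pow_two, h4, one_smul]

theorem height_act_eq_of_rightRel {γ γ' : modularGroup g}
    (h : QuotientGroup.rightRel (parabolic g ℤ) γ γ') {p : CoordIndex g → ℝ}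
    (hp : p ∈ coordDomain g) : height (act γ (ofCoords p)) = height (act γ' (ofCoords p)) := by
  rw [QuotientGroup.rightRel_apply] at h
  obtain ⟨t, ht, hrow⟩ := exists_bottomRow_of_mem_parabolic h
  have h1 : bottomRow γ' = t • bottomRow γ := by
    have : γ' = γ' * γ⁻¹ * γ := by group
    rw [this, bottomRow_mul, hrow, smul_vecMul, single_one_vecMul]
    rfl
  have h2 : (fun j => (bottomRow γ' j : ℝ)) = (t : ℝ) • fun j => (bottomRow γ j : ℝ) := by
    ext j; simp [h1]
  rw [height_act γ hp, height_act γ' hp, h2, quadForm_smul]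
  have h3 : (t : ℝ) ^ 2 = 1 := by exact_mod_cast ht
  rw [h3, one_mul]

/-- The quotient of two such matrices has a standard basis vector as bottom row, and `πJπᵀ = J`
converts this into fixing the first basis vector. -/
theorem rightRel_of_bottomRow_eq {γ γ' : modularGroup g} (h : bottomRow γ = bottomRow γ') :
    QuotientGroup.rightRel (parabolic g ℤ) γ γ' := by
  rw [QuotientGroup.rightRel_apply]
  set π := γ' * γ⁻¹
  have h1 : bottomRow π = Pi.single (Sum.inr 0) 1 := by
    rw [bottomRow_mul, ← h, ← bottomRow_mul, mul_inv_cancel]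
    ext j
    simp [bottomRow, one_apply, Pi.single_apply, eq_comm]
  refine ⟨1, ?_⟩
  have h2 : π.1 *ᵥ (J (Fin g) ℤ *ᵥ (π.1ᵀ *ᵥ Pi.single (Sum.inr 0) 1)) =
      J (Fin g) ℤ *ᵥ Pi.single (Sum.inr 0) 1 := by
    rw [mulVec_mulVec, mulVec_mulVec, SymplecticGroup.mem_iff.1 π.2]
  have h3 : π.1ᵀ *ᵥ Pi.single (Sum.inr 0) 1 = bottomRow π := by
    rw [mulVec_transpose, single_one_vecMul]
    rfl
  rw [h3, h1, J_mulVec_single, mulVec_neg, neg_inj] at h2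
  rw [h2, one_smul]

theorem bottomRow_out_injective : Function.Injective fun x : Cosets g => bottomRow x.out := by
  intro x y h
  rw [← Quotient.out_eq x, ← Quotient.out_eq y]
  exact Quotient.sound (rightRel_of_bottomRow_eq h)

end Cosets

/-! ### Convergence of the Eisenstein series and its Laplace equation. -/

section Series

open scoped ContDiff

theorem summable_norm_intCast_rpow {ι : Type*} [Fintype ι] {r : ℝ} (hr : r < -Fintype.card ι) :
    Summable fun n : ι → ℤ => ‖(fun j => (n j : ℝ))‖ ^ r := by
  classical
  set L := Submodule.span ℤ (Set.range (Pi.basisFun ℝ ι)) with hL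
  have hmem : ∀ n : ι → ℤ, (fun j => (n j : ℝ)) ∈ L := fun n => by
    rw [hL, Module.Basis.mem_span_iff_repr_mem]
    intro j
    simp
  have hs := ZLattice.summable_norm_rpow L r (by
    rw [ZLattice.rank ℝ L, Module.finrank_fintype_fun_eq_card]
    exact hr)
  refine hs.comp_injective (i := fun n : ι → ℤ => (⟨fun j => (n j : ℝ), hmem n⟩ : L)) ?_
  intro n n' h
  ext j
  have : (n j : ℝ) = n' j := congrFun (congrArg Subtype.val h) j
  exact_mod_cast this

variable {g : ℕ}

theorem contDiffOn_planeWave (s : ℂ) : ContDiffOn ℝ ∞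
    (fun q : (Fin g ⊕ Fin g → ℝ) × (CoordIndex g → ℝ) => planeWave s q.1 q.2)
    ({0}ᶜ ×ˢ coordDomain g) :=
  fun _ hq => (contDiffAt_planeWave s hq.1 hq.2).contDiffWithinAt

theorem sphere_subset_compl_zero :
    Metric.sphere (0 : Fin g ⊕ Fin g → ℝ) 1 ⊆ ({0}ᶜ : Set (Fin g ⊕ Fin g → ℝ)) := by
  rintro x hx rfl
  simp at hx

variable [NeZero g]

/-- The real vector given by the bottom row of the representative of a coset. -/
noncomputable def cosetVec (x : Cosets g) : Fin g ⊕ Fin g → ℝ := fun j => (bottomRow x.out j : ℝ)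

theorem cosetVec_ne_zero (x : Cosets g) : cosetVec x ≠ 0 := by
  intro h
  refine bottomRow_ne_zero x.out ?_
  ext j
  have : (bottomRow x.out j : ℝ) = 0 := congrFun h j
  exact_mod_cast this

theorem norm_cosetVec_pos (x : Cosets g) : 0 < ‖cosetVec x‖ := norm_pos_iff.2 (cosetVec_ne_zero x)

/-- The direction of the bottom row of a coset. -/
noncomputable def cosetDir (x : Cosets g) : Fin g ⊕ Fin g → ℝ := ‖cosetVec x‖⁻¹ • cosetVec x

theorem cosetDir_mem_sphere (x : Cosets g) : cosetDir x ∈ Metric.sphere (0 : Fin g ⊕ Fin g → ℝ) 1 := by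
  simp [cosetDir, norm_smul, (norm_cosetVec_pos x).ne']

/-- The factor of the term of a coset which depends on the length of the bottom row. -/
noncomputable def cosetWeight (s : ℂ) (x : Cosets g) : ℂ :=
  Complex.exp (-s * ((2 * Real.log ‖cosetVec x‖ : ℝ) : ℂ))

theorem summable_norm_cosetWeight {s : ℂ} (hs : (g : ℝ) < s.re) :
    Summable fun x : Cosets g => ‖cosetWeight s x‖ := by
  -- The lattice `ℤ^(2g)` has rank `2g`, so the condition is `2 Re s > 2g`; distinct cosets use
  -- distinct vectors.
  have h1 := (summable_norm_intCast_rpow (ι := Fin g ⊕ Fin g) (r := -(2 * s.re)) (by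
    simp; linarith)).comp_injective bottomRow_out_injective
  refine h1.congr fun x => ?_
  rw [cosetWeight, Complex.norm_exp, Complex.re_mul_ofReal, Complex.neg_re]
  change ‖cosetVec x‖ ^ (-(2 * s.re)) = _
  rw [Real.rpow_def_of_pos (norm_cosetVec_pos x)]
  congr 1
  ring

/-- Homogeneity of degree 2 separates the length of the row, independent of the point, from its
direction on the sphere. -/
theorem eisensteinTerm_eq (s : ℂ) {p : CoordIndex g → ℝ} (hp : p ∈ coordDomain g) (x : Cosets g) :
    eisensteinTerm (ofCoords p) s x = cosetWeight s x • planeWave s (cosetDir x) p := by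
  have hr := norm_cosetVec_pos x
  have h0 : cosetDir x ≠ 0 := by
    intro h
    have := cosetDir_mem_sphere x
    rw [h] at this
    simp at this
  have h1 : quadForm (cosetVec x) p = ‖cosetVec x‖ ^ 2 * quadForm (cosetDir x) p := by
    rw [← quadForm_smul, cosetDir, smul_smul, mul_inv_cancel₀ hr.ne', one_smul]
  have h2 : Real.log (quadForm (cosetVec x) p) =
      2 * Real.log ‖cosetVec x‖ + Real.log (quadForm (cosetDir x) p) := by
    rw [h1, Real.log_mul (by positivity) (quadForm_pos h0 hp).ne', Real.log_pow]
    norm_num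
  have h3 := quadForm_pos (cosetVec_ne_zero x) hp
  rw [eisensteinTerm, height_act _ hp]
  change (((quadForm (cosetVec x) p)⁻¹ : ℝ) : ℂ) ^ s = _
  rw [Complex.cpow_def_of_ne_zero (Complex.ofReal_ne_zero.2 (inv_ne_zero h3.ne')),
    ← Complex.ofReal_log (inv_pos.2 h3).le, Real.log_inv, h2, cosetWeight, planeWave, smul_eq_mul,
    ← Complex.exp_add]
  congr 1
  push_cast
  ring

theorem eisenstein_eq (s : ℂ) {p : CoordIndex g → ℝ} (hp : p ∈ coordDomain g) :
    eisenstein (ofCoords p) s = ∑' x : Cosets g, cosetWeight s x • planeWave s (cosetDir x) p :=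
  tsum_congr fun x => eisensteinTerm_eq s hp x

theorem summable_eisensteinTerm {s : ℂ} (hs : (g : ℝ) < s.re) {p : CoordIndex g → ℝ}
    (hp : p ∈ coordDomain g) : Summable (eisensteinTerm (ofCoords p) s) :=
  (summable_smul_of_isCompact (contDiffOn_planeWave s).continuousOn (isCompact_sphere _ _)
    sphere_subset_compl_zero cosetDir_mem_sphere (summable_norm_cosetWeight hs) hp).congr
    fun x => (eisensteinTerm_eq s hp x).symm

theorem contDiffOn_eisenstein {s : ℂ} (hs : (g : ℝ) < s.re) :
    ContDiffOn ℝ 2 (fun p => eisenstein (g := g) (ofCoords p) s) (coordDomain g) :=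
  (contDiffOn_tsum_smul 2 isOpen_compl_singleton isOpen_coordDomain (contDiffOn_planeWave s)
    (isCompact_sphere _ _) sphere_subset_compl_zero cosetDir_mem_sphere
    (summable_norm_cosetWeight hs)).congr fun _ hp => eisenstein_eq s hp

theorem partialDeriv_partialDeriv_congr {κ : Type*} [Fintype κ] [DecidableEq κ] (I J : κ)
    {f f₁ : (κ → ℝ) → ℂ} {Ω : Set (κ → ℝ)} (hΩ : IsOpen Ω) (h : Set.EqOn f f₁ Ω) {p : κ → ℝ}
    (hp : p ∈ Ω) :
    partialDeriv I (partialDeriv J f) p = partialDeriv I (partialDeriv J f₁) p :=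
  partialDeriv_congr_of_isOpen I hΩ (fun _ hq => partialDeriv_congr_of_isOpen J hΩ h hq) hp

theorem laplaceBeltrami_congr {κ : Type*} [Fintype κ] [DecidableEq κ]
    (G : (κ → ℝ) → Matrix κ κ ℝ) {f f₁ : (κ → ℝ) → ℂ} {Ω : Set (κ → ℝ)} (hΩ : IsOpen Ω)
    (h : Set.EqOn f f₁ Ω) {p : κ → ℝ} (hp : p ∈ Ω) :
    laplaceBeltrami G f p = laplaceBeltrami G f₁ p := by
  simp only [laplaceBeltrami]
  refine congrArg _ (congrArg _ (Finset.sum_congr rfl fun I _ => Finset.sum_congr rfl fun J _ => ?_))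
  refine partialDeriv_congr_of_isOpen I hΩ (fun q hq => ?_) hp
  simp only [partialDeriv_congr_of_isOpen J hΩ h hq]

theorem laplaceBeltrami_eisenstein {c : ℝ} (hc : IsNormalized g c) {s : ℂ} (hs : (g : ℝ) < s.re)
    {p : CoordIndex g → ℝ} (hp : p ∈ coordDomain g) :
    laplaceBeltrami (gram c) (fun p => eisenstein (ofCoords p) s) p =
      (((2 : ℝ) ^ (((g : ℝ) - 1) / ((g : ℝ) + 1)) : ℝ) : ℂ) * s * ((g : ℂ) - s) *
        eisenstein (ofCoords p) s := by
  rw [laplaceBeltrami_gram hc hp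
    ((contDiffOn_eisenstein hs).contDiffAt (isOpen_coordDomain.mem_nhds hp))]
  have h1 := fun I J => partialDeriv_partialDeriv_congr I J isOpen_coordDomain
    (fun q hq => eisenstein_eq (g := g) s hq) hp
  have h2 := sum_partialDeriv_tsum_smul
    (fun I J => ((fromBlocks (invGramBlock c p) 0 0 (invGramBlock c p) I J : ℝ) : ℂ))
    isOpen_compl_singleton isOpen_coordDomain (contDiffOn_planeWave s)
    (isCompact_sphere _ _) sphere_subset_compl_zero cosetDir_mem_sphere
    (summable_norm_cosetWeight hs) hp
  have h3 : ∀ x : Cosets g, cosetDir x ≠ 0 := fun x =>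
    sphere_subset_compl_zero (cosetDir_mem_sphere x)
  simp_rw [h1]
  rw [h2, eisenstein_eq s hp, ← tsum_neg, ← tsum_mul_left]
  refine tsum_congr fun x => ?_
  rw [sum_invGramBlock_planeWave c s (h3 x) hp, inv_normalization hc, smul_eq_mul, smul_eq_mul]
  ring

end Series

/-! ### Analytic continuation in `s`. -/

section Continuation

open Filter Topology

/-- The difference quotients in the direction `e` are holomorphic in `s`. Strict differentiability
makes them converge locally uniformly, and such limits are holomorphic. -/
theorem differentiableOn_fderivRight {E : Type*} [NormedAddCommGroup E] [NormedSpace ℝ E]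
    {Φ : ℂ × E → ℂ} {U : Set ℂ} {Ω : Set E} (hU : IsOpen U) (hΩ : IsOpen Ω)
    (hΦ : ContDiffOn ℝ 1 Φ (U ×ˢ Ω))
    (hhol : ∀ q ∈ Ω, DifferentiableOn ℂ (fun s => Φ (s, q)) U) {p : E} (hp : p ∈ Ω) (e : E) :
    DifferentiableOn ℂ (fun s => fderivRight Φ (s, p) e) U := by
  have hline : Continuous fun t : ℝ => p + t • e := by fun_prop
  have hlim : TendstoLocallyUniformlyOn
      (fun (t : ℝ) (s : ℂ) => ((t⁻¹ : ℝ) : ℂ) * (Φ (s, p + t • e) - Φ (s, p)))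
      (fun s => fderivRight Φ (s, p) e) (𝓝[≠] (0 : ℝ)) U := by
    rw [Metric.tendstoLocallyUniformlyOn_iff]
    intro ε hε s₀ hs₀
    have hmem : U ×ˢ Ω ∈ 𝓝 (s₀, p) := (hU.prod hΩ).mem_nhds ⟨hs₀, hp⟩
    have hstrict := (hΦ.contDiffAt hmem).hasStrictFDerivAt one_ne_zero
    -- The tolerance is divided by `‖e‖ + 1` rather than `‖e‖`, so that `e = 0` needs no separate
    -- case.
    have hη : 0 < ε / (2 * (‖e‖ + 1)) := by positivity
    have h1 := hstrict.isLittleO.def hη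
    have hcont : Tendsto (fun z : ℂ × ℝ => ((z.1, p + z.2 • e), (z.1, p))) (𝓝 (s₀, 0))
        (𝓝 ((s₀, p), (s₀, p))) := by
      have : Continuous fun z : ℂ × ℝ => ((z.1, p + z.2 • e), (z.1, p)) := by fun_prop
      simpa using this.tendsto (s₀, 0)
    have h2 := hcont.eventually h1
    rw [nhds_prod_eq, eventually_prod_iff] at h2
    obtain ⟨A, hA, B, hB, hAB⟩ := h2
    have hg : ContinuousAt (fun s => fderivRight Φ (s, p) e) s₀ := by
      have h3 : ContinuousAt (fderivRight Φ) (s₀, p) :=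
        (contDiffOn_fderivRight (m := 0) (hU.prod hΩ) (by simp) hΦ).continuousOn.continuousAt hmem
      exact (ContinuousAt.comp (f := fun s => (s, p)) h3 (by fun_prop)).clm_apply continuousAt_const
    have hg' := Metric.continuousAt_iff'.1 hg (ε / 2) (by positivity)
    refine ⟨{s | A s} ∩ {s | dist (fderivRight Φ (s, p) e) (fderivRight Φ (s₀, p) e) < ε / 2},
      mem_nhdsWithin_of_mem_nhds (inter_mem hA hg'), ?_⟩
    filter_upwards [mem_nhdsWithin_of_mem_nhds hB, self_mem_nhdsWithin] with t ht ht0 s hs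
    have ht0' : t ≠ 0 := ht0
    have h4 := hAB hs.1 ht
    have h5 : ((s, p + t • e) - (s, p) : ℂ × E) = t • ((0 : ℂ), e) := by
      ext <;> simp
    rw [h5, map_smul, norm_smul, Prod.norm_mk, norm_zero, max_eq_right (norm_nonneg e)] at h4
    have h6 : dist (fderivRight Φ (s₀, p) e)
        (((t⁻¹ : ℝ) : ℂ) * (Φ (s, p + t • e) - Φ (s, p))) < ε / 2 := by
      have h7 : ((t⁻¹ : ℝ) : ℂ) * (Φ (s, p + t • e) - Φ (s, p)) - fderivRight Φ (s₀, p) e =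
          t⁻¹ • (Φ (s, p + t • e) - Φ (s, p) - t • fderiv ℝ Φ (s₀, p) (0, e)) := by
        rw [smul_sub, smul_smul, inv_mul_cancel₀ ht0', one_smul, Complex.real_smul]
        rfl
      rw [dist_comm, dist_eq_norm, h7, norm_smul, norm_inv]
      have ht1 : 0 < ‖t‖ := norm_pos_iff.2 ht0'
      calc ‖t‖⁻¹ * _ ≤ ‖t‖⁻¹ * (ε / (2 * (‖e‖ + 1)) * (‖t‖ * ‖e‖)) := by gcongr
        _ = ε / 2 * (‖e‖ / (‖e‖ + 1)) := by field_simp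
        _ < ε / 2 * 1 := by
          refine mul_lt_mul_of_pos_left ?_ (by positivity)
          rw [div_lt_one (by positivity)]
          linarith
        _ = ε / 2 := mul_one _
    calc dist (fderivRight Φ (s, p) e) _ ≤ _ := dist_triangle _ (fderivRight Φ (s₀, p) e) _
      _ < ε / 2 + ε / 2 := add_lt_add hs.2 h6
      _ = ε := add_halves ε
  refine hlim.differentiableOn ?_ hU
  have hev : ∀ᶠ t in 𝓝[≠] (0 : ℝ), p + t • e ∈ Ω :=
    (hline.tendsto 0).eventually (hΩ.mem_nhds (by simpa using hp)) |>.filter_mono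
      nhdsWithin_le_nhds
  filter_upwards [hev] with t ht
  exact ((hhol _ ht).sub (hhol p hp)).const_mul _

theorem differentiableOn_partialDeriv {κ : Type*} [Fintype κ] [DecidableEq κ] (J : κ)
    {Φ : ℂ × (κ → ℝ) → ℂ} {U : Set ℂ} {Ω : Set (κ → ℝ)} (hU : IsOpen U) (hΩ : IsOpen Ω)
    (hΦ : ContDiffOn ℝ 1 Φ (U ×ˢ Ω))
    (hhol : ∀ q ∈ Ω, DifferentiableOn ℂ (fun s => Φ (s, q)) U) {p : κ → ℝ} (hp : p ∈ Ω) :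
    DifferentiableOn ℂ (fun s => partialDeriv J (fun q => Φ (s, q)) p) U :=
  (differentiableOn_fderivRight hU hΩ hΦ hhol hp (Pi.single J 1)).congr fun _ hs =>
    partialDeriv_right J ((hΦ.contDiffAt ((hU.prod hΩ).mem_nhds ⟨hs, hp⟩)).differentiableAt
      one_ne_zero)

/-- At a fixed point the Laplacian is a finite combination, with coefficients independent of `s`, of
second derivatives that are holomorphic in `s`, so the identity theorem spreads the equation from
near `s₀` to `U`. -/
theorem laplaceBeltrami_eq_of_continuation {g : ℕ} {c : ℝ} (hc : IsNormalized g c)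
    {Φ : ℂ × (CoordIndex g → ℝ) → ℂ} {U : Set ℂ} (hU : IsOpen U) (hUc : IsPreconnected U)
    (hΦ : ContDiffOn ℝ 2 Φ (U ×ˢ coordDomain g))
    (hhol : ∀ q ∈ coordDomain g, DifferentiableOn ℂ (fun s => Φ (s, q)) U)
    {lam : ℂ → ℂ} (hlam : Differentiable ℂ lam) {p : CoordIndex g → ℝ} (hp : p ∈ coordDomain g)
    {s₀ : ℂ} (hs₀ : s₀ ∈ U)
    (heq : ∀ᶠ s in 𝓝 s₀, laplaceBeltrami (gram c) (fun q => Φ (s, q)) p = lam s * Φ (s, p))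
    {s : ℂ} (hs : s ∈ U) :
    laplaceBeltrami (gram c) (fun q => Φ (s, q)) p = lam s * Φ (s, p) := by
  have hD : DifferentiableOn ℂ (fun s => laplaceBeltrami (gram c) (fun q => Φ (s, q)) p) U := by
    have h1 : ∀ s ∈ U, ContDiffAt ℝ 2 (fun q => Φ (s, q)) p := fun s hs =>
      ContDiffAt.comp (f := fun q => (s, q)) p
        (hΦ.contDiffAt ((hU.prod isOpen_coordDomain).mem_nhds ⟨hs, hp⟩)) (by fun_prop)
    refine DifferentiableOn.congr ?_ fun s hs => laplaceBeltrami_gram hc hp (h1 s hs)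
    refine (DifferentiableOn.fun_sum fun I _ => DifferentiableOn.fun_sum fun J _ =>
      DifferentiableOn.const_mul ?_ _).neg
    exact differentiableOn_partialDeriv I hU isOpen_coordDomain
      (contDiffOn_partialDeriv_right J hU isOpen_coordDomain (m := 1) (by norm_num) hΦ)
      (fun q hq => differentiableOn_partialDeriv J hU isOpen_coordDomain
        (hΦ.of_le (by norm_num)) hhol hq) hp
  exact (hD.analyticOnNhd hU).eqOn_of_preconnected_of_eventuallyEq
    ((hlam.differentiableOn.mul (hhol p hp)).analyticOnNhd hU) hUc hs₀ heq hs

end Continuation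

end Siegel

theorem mainTheorem4 (g : ℕ) [NeZero g] (c : ℝ) (hc : Siegel.IsNormalized g c) :
    -- the terms of the series depend only on the coset
    (∀ γ γ' : Siegel.modularGroup g,
      QuotientGroup.rightRel (Siegel.parabolic g ℤ) γ γ' →
      ∀ τ ∈ Siegel.upperHalfSpace g,
        Siegel.height (Siegel.act γ τ) = Siegel.height (Siegel.act γ' τ)) ∧
    -- the region of convergence
    (∀ s : ℂ, (g : ℝ) < s.re →
      (∀ τ ∈ Siegel.upperHalfSpace g, Summable (Siegel.eisensteinTerm τ s)) ∧
      ContDiffOn ℝ 2 (fun p => Siegel.eisenstein (Siegel.ofCoords p) s) (Siegel.coordDomain g) ∧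
      ∀ τ ∈ Siegel.upperHalfSpace g,
        Siegel.laplacian c (fun τ' => Siegel.eisenstein τ' s) τ =
          (((2 : ℝ) ^ (((g : ℝ) - 1) / ((g : ℝ) + 1)) : ℝ) : ℂ) * s * ((g : ℂ) - s) *
            Siegel.eisenstein τ s) ∧
    -- the analytic continuation in `s`
    (∀ (U : Set ℂ) (F : Matrix (Fin g) (Fin g) ℂ → ℂ → ℂ),
      IsOpen U → IsPreconnected U → (U ∩ {s : ℂ | (g : ℝ) < s.re}).Nonempty →
      ContDiffOn ℝ 2 (fun q : (Siegel.CoordIndex g → ℝ) × ℂ => F (Siegel.ofCoords q.1) q.2)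
        (Siegel.coordDomain g ×ˢ U) →
      (∀ τ ∈ Siegel.upperHalfSpace g, DifferentiableOn ℂ (F τ) U) →
      (∀ τ ∈ Siegel.upperHalfSpace g, ∀ s ∈ U, (g : ℝ) < s.re → F τ s = Siegel.eisenstein τ s) →
      ∀ τ ∈ Siegel.upperHalfSpace g, ∀ s ∈ U,
        Siegel.laplacian c (fun τ' => F τ' s) τ =
          (((2 : ℝ) ^ (((g : ℝ) - 1) / ((g : ℝ) + 1)) : ℝ) : ℂ) * s * ((g : ℂ) - s) * F τ s) := by
  have hpt : ∀ τ ∈ Siegel.upperHalfSpace g,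
      Siegel.coords τ ∈ Siegel.coordDomain g ∧ Siegel.ofCoords (Siegel.coords τ) = τ :=
    fun τ hτ => ⟨Siegel.coords_mem_coordDomain hτ, Siegel.ofCoords_coords hτ.1⟩
  have hregion : ∀ s : ℂ, (g : ℝ) < s.re → ∀ τ ∈ Siegel.upperHalfSpace g,
      Siegel.laplacian c (fun τ' => Siegel.eisenstein τ' s) τ =
        (((2 : ℝ) ^ (((g : ℝ) - 1) / ((g : ℝ) + 1)) : ℝ) : ℂ) * s * ((g : ℂ) - s) *
          Siegel.eisenstein τ s := by
    intro s hs τ hτ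
    have h := Siegel.laplaceBeltrami_eisenstein hc hs (hpt τ hτ).1
    rwa [(hpt τ hτ).2] at h
  refine ⟨fun γ γ' h τ hτ => ?_, fun s hs => ⟨fun τ hτ => ?_, Siegel.contDiffOn_eisenstein hs,
    hregion s hs⟩, fun U F hU hUc hne hF hhol heq τ hτ s hs => ?_⟩
  · rw [← (hpt τ hτ).2]
    exact Siegel.height_act_eq_of_rightRel h (hpt τ hτ).1
  · rw [← (hpt τ hτ).2]
    exact Siegel.summable_eisensteinTerm hs (hpt τ hτ).1
  · obtain ⟨s₀, hs₀, hre⟩ := hne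
    have hΦ : ContDiffOn ℝ 2 (fun q : ℂ × (Siegel.CoordIndex g → ℝ) =>
        F (Siegel.ofCoords q.2) q.1) (U ×ˢ Siegel.coordDomain g) :=
      hF.comp (contDiff_snd.prodMk contDiff_fst).contDiffOn fun q hq => ⟨hq.2, hq.1⟩
    have hmain := Siegel.laplaceBeltrami_eq_of_continuation hc hU hUc hΦ
      (fun q hq => hhol _ hq)
      (lam := fun s => (((2 : ℝ) ^ (((g : ℝ) - 1) / ((g : ℝ) + 1)) : ℝ) : ℂ) * s * ((g : ℂ) - s))
      (by fun_prop) (hpt τ hτ).1 hs₀ ?_ hs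
    · simp only [(hpt τ hτ).2] at hmain
      exact hmain
    · have hopen : IsOpen {s : ℂ | (g : ℝ) < s.re} :=
        isOpen_lt continuous_const Complex.continuous_re
      filter_upwards [hU.mem_nhds hs₀, hopen.mem_nhds hre] with z hz hzre
      have h1 : Siegel.laplaceBeltrami (Siegel.gram c)
          (fun q => F (Siegel.ofCoords q) z) (Siegel.coords τ) =
          Siegel.laplaceBeltrami (Siegel.gram c)
          (fun q => Siegel.eisenstein (Siegel.ofCoords q) z) (Siegel.coords τ) :=
        Siegel.laplaceBeltrami_congr _ Siegel.isOpen_coordDomain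
          (fun q hq => heq _ hq z hz hzre) (hpt τ hτ).1
      rw [h1, heq _ (hpt τ hτ).1 z hz hzre]
      exact Siegel.laplaceBeltrami_eisenstein hc hzre (hpt τ hτ).1
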